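/- Let $\mathbb K\in\{\mathbb R,\mathbb C\}$, let $1\le p,q<\infty$, $0\le\theta,\nu<1$ and $1\le r<\infty$ with $\frac1r+\frac{1-\theta}{p}+\frac{1-\nu}{q}=1$. All Banach spaces are over $\mathbb K$. All metric spaces are pointed, with distinguished point $0$ (the zero vector in a Banach space). $\mathrm{Lip}(X,Y)$ denotes the set of Lipschitz maps $T:X\to Y$ with $T(0)=0$, $\mathrm{Lip}(T)$ the least Lipschitz constant of $T$, $X^{\#}=\mathrm{Lip}(X,\mathbb K)$, and $B_{X^{\#}}=\{f\in X^{\#}:\mathrm{Lip}(f)\le 1\}$. A map $S\in\mathrm{Lip}(X,G)$ into a Banach space $G$ is Lipschitz $p$-summing, $S\in\Pi_p^L(X,G)$, if there is $C\ge0$ with $$\Big(\sum_{j=1}^m\lambda_j^p\|Sx_j'-Sx_j''\|^p\Big)^{1/p}\le C\sup_{f\in B_{X^{\#}}}\Big(\sum_{j=1}^m\lambda_j^p|f(x_j')-f(x_j'')|^p\Big)^{1/p}$$ for all $m\in\mathbb N$, $x_j',x_j''\in X$, $\lambda_j\ge0$; $\pi_p^L(S)$ is the infimum of such $C$. A bounded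 linear operator $R:E\to H$ between Banach spaces is $q$-summing, $R\in\Pi_q(E,H)$, if there is $C\ge0$ with $\big(\sum_{j=1}^m\|Rx_j\|^q\big)^{1/q}\le C\sup_{a\in B_{E^*}}\big(\sum_{j=1}^m|\langle x_j,a\rangle|^q\big)^{1/q}$ for all $m\in\mathbb N$ and $x_1,\dots,x_m\in E$; $\pi_q(R)$ is the infimum of such $C$. For a metric space $X$ and a Banach space $F$, let $\mathcal D^L_{(p,\theta,q,\nu)}(X,F)$ be the set of all $T\in\mathrm{Lip}(X,F)$ for which there are Banach spaces $G,H$, a map $S\in\Pi_p^L(X,G)$, an operator $R\in\Pi_q(F^*,H)$ and a constant $C>0$ such that $$|\langle Tx'-Tx'',b^*\rangle|\le C\,d_X(x',x'')^{\theta}\,\|Sx'-Sx''\|^{1-\theta}\,\|b^*\|^{\nu}\,\|Rb^*\|^{1-\nu}\qquad(x',x''\in X,\ b^*\in F^*),$$ and let $D^L_{(p,\theta,q,\nu)}(T)$ be the infimum of $C\,\pi_p^L(S)^{1-\theta}\,\pi_q(R)^{1-\nu}$ over all such $G,H,S,R,C$. Then $[\mathcal D^L,D^L]=[\mathcal D^L_{(p,\theta,q,\nu)},D^L_{(p,\theta,q,\nu)}]$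 is a Banach nonlinear ideal between metric spaces and Banach spaces. That is, for all metric spaces $X,X_0$ and Banach spaces $F,F_0$: 1. for $g\in X^{\#}$ and $e\in F$ the map $g\boxdot e:x\mapsto g(x)e$ belongs to $\mathcal D^L(X,F)$, and $D^L(g\boxdot e)=\mathrm{Lip}(g)\|e\|$; 2. if $S,T\in\mathcal D^L(X,F)$, then $S+T\in\mathcal D^L(X,F)$ and $D^L(S+T)\le D^L(S)+D^L(T)$; 3. if $A\in\mathrm{Lip}(X_0,X)$, $T\in\mathcal D^L(X,F)$ and $B:F\to F_0$ is bounded and linear, then $BTA\in\mathcal D^L(X_0,F_0)$ and $D^L(BTA)\le\|B\|\,D^L(T)\,\mathrm{Lip}(A)$; 4. $\mathcal D^L(X,F)$ is a linear space, $D^L$ is a norm on it, and it is complete under this norm. -/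

import Mathlib

open Filter Topology

universe u

noncomputable section

namespace NonlinearIdeal

/-! Metric spaces are pointed, as usual for spaces of Lipschitz maps normed by the Lipschitz
constant: the distinguished point is written `0`. For a normed space it is the zero vector. -/

/-- `T` belongs to `Lip(X, Y)`: it is Lipschitz and preserves the distinguished point. -/
def IsLip {X Y : Type*} [MetricSpace X] [Zero X] [MetricSpace Y] [Zero Y] (T : X → Y) : Prop :=
  T 0 = 0 ∧ ∃ K : ℝ, 0 ≤ K ∧ ∀ x y, dist (T x) (T y) ≤ K * dist x y

/-- The Lipschitz constant `Lip(T)`. -/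
def lipConst {X Y : Type*} [MetricSpace X] [MetricSpace Y] (T : X → Y) : ℝ :=
  sInf {K : ℝ | 0 ≤ K ∧ ∀ x y, dist (T x) (T y) ≤ K * dist x y}

/-- The closed unit ball of the Lipschitz dual `X^# = Lip(X, 𝕜)`. -/
def lipDualBall (𝕜 : Type) [RCLike 𝕜] (X : Type*) [MetricSpace X] [Zero X] : Set (X → 𝕜) :=
  {f | IsLip f ∧ lipConst f ≤ 1}

/-- The strong `ℓ_p` norm of a finite family of weighted pairs of points. -/
def strongLipNorm {X : Type*} [MetricSpace X] (p : ℝ) {m : ℕ} (σ : Fin m → ℝ)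
    (x' x'' : Fin m → X) : ℝ :=
  (∑ j, |σ j| ^ p * dist (x' j) (x'' j) ^ p) ^ (1 / p)

/-- The weak Lipschitz `ℓ_p` norm of a finite family of weighted pairs of points. -/
def weakLipNorm (𝕜 : Type) [RCLike 𝕜] {X : Type*} [MetricSpace X] [Zero X] (p : ℝ) {m : ℕ}
    (σ : Fin m → ℝ) (x' x'' : Fin m → X) : ℝ :=
  ⨆ f : lipDualBall 𝕜 X,
    (∑ j, |σ j| ^ p * ‖(f : X → 𝕜) (x' j) - (f : X → 𝕜) (x'' j)‖ ^ p) ^ (1 / p)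

/-- `C` is an admissible constant in the definition of Lipschitz `p`-summing maps. -/
def LipSummingBound (𝕜 : Type) [RCLike 𝕜] {X Y : Type*} [MetricSpace X] [Zero X] [MetricSpace Y]
    (p : ℝ) (T : X → Y) (C : ℝ) : Prop :=
  0 ≤ C ∧ ∀ (m : ℕ) (σ : Fin m → ℝ) (x' x'' : Fin m → X), (∀ j, 0 ≤ σ j) →
    strongLipNorm p σ (fun j => T (x' j)) (fun j => T (x'' j)) ≤ C * weakLipNorm 𝕜 p σ x' x''

/-- `T ∈ Π_p^L(X, Y)`: `T` is a Lipschitz `p`-summing map. -/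
def IsLipSumming (𝕜 : Type) [RCLike 𝕜] {X Y : Type*} [MetricSpace X] [Zero X] [MetricSpace Y]
    [Zero Y] (p : ℝ) (T : X → Y) : Prop :=
  IsLip T ∧ ∃ C, LipSummingBound 𝕜 p T C

/-- The Lipschitz `p`-summing norm `π_p^L(T)`. -/
def lipSummingNorm (𝕜 : Type) [RCLike 𝕜] {X Y : Type*} [MetricSpace X] [Zero X] [MetricSpace Y]
    (p : ℝ) (T : X → Y) : ℝ :=
  sInf {C | LipSummingBound 𝕜 p T C}

/-- `C` is an admissible constant in the definition of (linear) `q`-summing operators. -/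
def SummingBound {𝕜 : Type} [RCLike 𝕜] {E H : Type*} [NormedAddCommGroup E] [NormedSpace 𝕜 E]
    [NormedAddCommGroup H] [NormedSpace 𝕜 H] (q : ℝ) (R : E →L[𝕜] H) (C : ℝ) : Prop :=
  0 ≤ C ∧ ∀ (m : ℕ) (x : Fin m → E),
    (∑ j, ‖R (x j)‖ ^ q) ^ (1 / q) ≤
      C * ⨆ a : Metric.closedBall (0 : StrongDual 𝕜 E) 1,
        (∑ j, ‖(a : StrongDual 𝕜 E) (x j)‖ ^ q) ^ (1 / q)

/-- `R ∈ Π_q(E, H)`: `R` is a `q`-summing operator. -/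
def IsSumming {𝕜 : Type} [RCLike 𝕜] {E H : Type*} [NormedAddCommGroup E] [NormedSpace 𝕜 E]
    [NormedAddCommGroup H] [NormedSpace 𝕜 H] (q : ℝ) (R : E →L[𝕜] H) : Prop :=
  ∃ C, SummingBound q R C

/-- The `q`-summing norm `π_q(R)`. -/
def summingNorm {𝕜 : Type} [RCLike 𝕜] {E H : Type*} [NormedAddCommGroup E] [NormedSpace 𝕜 E]
    [NormedAddCommGroup H] [NormedSpace 𝕜 H] (q : ℝ) (R : E →L[𝕜] H) : ℝ :=
  sInf {C | SummingBound q R C}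

/-- The triple `(S, R, C)` witnesses that `T` is Lipschitz `(p, θ, q, ν)`-dominated. -/
def Dominates {𝕜 : Type} [RCLike 𝕜] {X F G H : Type*} [MetricSpace X] [Zero X]
    [NormedAddCommGroup F] [NormedSpace 𝕜 F] [NormedAddCommGroup G] [NormedSpace 𝕜 G]
    [NormedAddCommGroup H] [NormedSpace 𝕜 H] (p θ q ν : ℝ) (T : X → F)
    (S : X → G) (R : StrongDual 𝕜 F →L[𝕜] H) (C : ℝ) : Prop :=
  IsLipSumming 𝕜 p S ∧ IsSumming q R ∧ 0 < C ∧
    ∀ (x' x'' : X) (b : StrongDual 𝕜 F),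
      ‖b (T x' - T x'')‖ ≤
        C * dist x' x'' ^ θ * ‖S x' - S x''‖ ^ (1 - θ) * ‖b‖ ^ ν * ‖R b‖ ^ (1 - ν)

/-- The class of Lipschitz `(p, θ, q, ν)`-dominated operators from `X` to `F`. -/
def dominated (𝕜 : Type) [RCLike 𝕜] (p θ q ν : ℝ) (X F : Type u) [MetricSpace X] [Zero X]
    [NormedAddCommGroup F] [NormedSpace 𝕜 F] [CompleteSpace F] : Set (X → F) :=
  {T | IsLip T ∧
    ∃ (G : Type u) (_ : NormedAddCommGroup G) (_ : NormedSpace 𝕜 G) (_ : CompleteSpace G)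
      (H : Type u) (_ : NormedAddCommGroup H) (_ : NormedSpace 𝕜 H) (_ : CompleteSpace H)
      (S : X → G) (R : StrongDual 𝕜 F →L[𝕜] H) (C : ℝ), Dominates p θ q ν T S R C}

/-- The Lipschitz `(p, θ, q, ν)`-dominated norm of `T`. -/
def dominatedNorm (𝕜 : Type) [RCLike 𝕜] (p θ q ν : ℝ) (X F : Type u) [MetricSpace X] [Zero X]
    [NormedAddCommGroup F] [NormedSpace 𝕜 F] [CompleteSpace F] (T : X → F) : ℝ :=
  sInf {c | ∃ (G : Type u) (_ : NormedAddCommGroup G) (_ : NormedSpace 𝕜 G) (_ : CompleteSpace G)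
      (H : Type u) (_ : NormedAddCommGroup H) (_ : NormedSpace 𝕜 H) (_ : CompleteSpace H)
      (S : X → G) (R : StrongDual 𝕜 F →L[𝕜] H) (C : ℝ), Dominates p θ q ν T S R C ∧
      c = C * lipSummingNorm 𝕜 p S ^ (1 - θ) * summingNorm q R ^ (1 - ν)}

/-- A complete `s`-normed nonlinear ideal (`0 < s ≤ 1`) between pointed metric spaces and Banach
spaces: `A X F` is the component of the ideal at `(X, F)` and `N X F` is its Lipschitz `s`-norm
(only its values on `A X F` matter). -/
structure IsCompleteNormedNonlinearIdeal (𝕜 : Type) [RCLike 𝕜] (s : ℝ)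
    (A : ∀ (X F : Type u) [MetricSpace X] [Zero X] [NormedAddCommGroup F] [NormedSpace 𝕜 F]
      [CompleteSpace F], Set (X → F))
    (N : ∀ (X F : Type u) [MetricSpace X] [Zero X] [NormedAddCommGroup F] [NormedSpace 𝕜 F]
      [CompleteSpace F], (X → F) → ℝ) : Prop where
  exponent_pos : 0 < s
  exponent_le_one : s ≤ 1
  isLip : ∀ (X F : Type u) [MetricSpace X] [Zero X] [NormedAddCommGroup F] [NormedSpace 𝕜 F]
    [CompleteSpace F] (T : X → F), T ∈ A X F → IsLip T
  /-- Elementary Lipschitz tensors `g ⊡ e : x ↦ g x • e` belong to the ideal. -/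
  tensor_mem : ∀ (X F : Type u) [MetricSpace X] [Zero X] [NormedAddCommGroup F] [NormedSpace 𝕜 F]
    [CompleteSpace F] (g : X → 𝕜) (e : F), IsLip g → (fun x => g x • e) ∈ A X F
  tensor_norm : ∀ (X F : Type u) [MetricSpace X] [Zero X] [NormedAddCommGroup F]
    [NormedSpace 𝕜 F] [CompleteSpace F] (g : X → 𝕜) (e : F), IsLip g →
    N X F (fun x => g x • e) = lipConst g * ‖e‖
  add_mem : ∀ (X F : Type u) [MetricSpace X] [Zero X] [NormedAddCommGroup F] [NormedSpace 𝕜 F]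
    [CompleteSpace F] (S T : X → F), S ∈ A X F → T ∈ A X F → S + T ∈ A X F
  add_norm : ∀ (X F : Type u) [MetricSpace X] [Zero X] [NormedAddCommGroup F] [NormedSpace 𝕜 F]
    [CompleteSpace F] (S T : X → F), S ∈ A X F → T ∈ A X F →
    N X F (S + T) ^ s ≤ N X F S ^ s + N X F T ^ s
  comp_mem : ∀ (X₀ X F F₀ : Type u) [MetricSpace X₀] [Zero X₀] [MetricSpace X] [Zero X]
    [NormedAddCommGroup F] [NormedSpace 𝕜 F] [CompleteSpace F]
    [NormedAddCommGroup F₀] [NormedSpace 𝕜 F₀] [CompleteSpace F₀]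
    (B : F →L[𝕜] F₀) (T : X → F) (A₀ : X₀ → X), IsLip A₀ → T ∈ A X F →
    (fun x => B (T (A₀ x))) ∈ A X₀ F₀
  comp_norm : ∀ (X₀ X F F₀ : Type u) [MetricSpace X₀] [Zero X₀] [MetricSpace X] [Zero X]
    [NormedAddCommGroup F] [NormedSpace 𝕜 F] [CompleteSpace F]
    [NormedAddCommGroup F₀] [NormedSpace 𝕜 F₀] [CompleteSpace F₀]
    (B : F →L[𝕜] F₀) (T : X → F) (A₀ : X₀ → X), IsLip A₀ → T ∈ A X F →
    N X₀ F₀ (fun x => B (T (A₀ x))) ≤ ‖B‖ * N X F T * lipConst A₀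
  /-- The components are linear spaces on which `N` is a (nonnegative, definite, absolutely
  homogeneous) `s`-norm. -/
  smul_mem : ∀ (X F : Type u) [MetricSpace X] [Zero X] [NormedAddCommGroup F] [NormedSpace 𝕜 F]
    [CompleteSpace F] (c : 𝕜) (T : X → F), T ∈ A X F → c • T ∈ A X F
  norm_nonneg : ∀ (X F : Type u) [MetricSpace X] [Zero X] [NormedAddCommGroup F]
    [NormedSpace 𝕜 F] [CompleteSpace F] (T : X → F), T ∈ A X F → 0 ≤ N X F T
  norm_eq_zero : ∀ (X F : Type u) [MetricSpace X] [Zero X] [NormedAddCommGroup F]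
    [NormedSpace 𝕜 F] [CompleteSpace F] (T : X → F), T ∈ A X F → (N X F T = 0 ↔ T = 0)
  norm_smul : ∀ (X F : Type u) [MetricSpace X] [Zero X] [NormedAddCommGroup F]
    [NormedSpace 𝕜 F] [CompleteSpace F] (c : 𝕜) (T : X → F), T ∈ A X F →
    N X F (c • T) = ‖c‖ * N X F T
  /-- The components are complete: every Cauchy sequence converges. -/
  complete : ∀ (X F : Type u) [MetricSpace X] [Zero X] [NormedAddCommGroup F] [NormedSpace 𝕜 F]
    [CompleteSpace F] (T : ℕ → X → F), (∀ n, T n ∈ A X F) →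
    (∀ ε : ℝ, 0 < ε → ∃ n₀, ∀ m ≥ n₀, ∀ n ≥ n₀, N X F (T m - T n) < ε) →
    ∃ T' ∈ A X F, Tendsto (fun n => N X F (T n - T')) atTop (𝓝 0)

/-- A Banach nonlinear ideal is a complete `1`-normed nonlinear ideal. -/
def IsBanachNonlinearIdeal (𝕜 : Type) [RCLike 𝕜]
    (A : ∀ (X F : Type u) [MetricSpace X] [Zero X] [NormedAddCommGroup F] [NormedSpace 𝕜 F]
      [CompleteSpace F], Set (X → F))
    (N : ∀ (X F : Type u) [MetricSpace X] [Zero X] [NormedAddCommGroup F] [NormedSpace 𝕜 F]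
      [CompleteSpace F], (X → F) → ℝ) : Prop :=
  IsCompleteNormedNonlinearIdeal 𝕜 1 A N

end NonlinearIdeal

end

namespace NonlinearIdeal

/-! ### Elementary inequalities -/

/-! By homogeneity the factor maps can be rescaled so that both summing norms are at most one,
leaving a single constant `t`; this is `DominatedBound`. A dominated map whose norm is below `t`
satisfies it (`dominatedBound_of_dominatedNorm_lt`), and a map satisfying it is dominated with norm
at most `t` (`DominatedBound.dominatedNorm_le`). Thus each norm inequality reduces to a construction
with normalised factors, followed by a passage to the infimum.

The heart is `DominatedBound.hasSum`. If the `T i` have constants `t i` with sum `t'`, then `w i = t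
i / t'` are probability weights. The maps with coordinates `w i ^ (1/p) • S i` and `w i ^ (1/q) • R
i` into `ℓ_p` and `ℓ_q` sums are again summing with constant one, because the `p`-th and `q`-th
powers of their norms are weighted averages. Hölder's inequality with exponents `p / (1 - θ)` and `q
/ (1 - ν)`, and the constant `1` absorbing the remaining `1 / r`, then recombines the individual
estimates.

Two terms give the triangle inequality; infinitely many, applied to the increments of a fast
subsequence, give completeness. Composition transports the factors to `S ∘ A` and `R ∘ B*`.
Elementary tensors factor through the scalars, and the lower bound for their norm, like
definiteness, comes from the fact that the dominated norm majorises the Lipschitz constant. -/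

lemma le_sInf_mul {s : Set ℝ} (hs : s.Nonempty) {a W : ℝ} (hW : 0 ≤ W)
    (h : ∀ C ∈ s, a ≤ C * W) : a ≤ sInf s * W := by
  rcases hW.eq_or_lt with rfl | hW
  · obtain ⟨C, hC⟩ := hs
    simpa using h C hC
  · rw [← div_le_iff₀ hW]
    exact le_csInf hs fun C hC => (div_le_iff₀ hW).2 (h C hC)

lemma le_rpow_mul_rpow_one_sub {u d θ : ℝ} (hu : 0 ≤ u) (hud : u ≤ d) (hθ : 0 ≤ θ) :
    u ≤ d ^ θ * u ^ (1 - θ) := by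
  calc u = u ^ θ * u ^ (1 - θ) := by
        rw [← Real.rpow_add' hu (by simp)]; simp
    _ ≤ d ^ θ * u ^ (1 - θ) := by gcongr

lemma rpow_mul_rpow_one_sub_le {u d θ : ℝ} (hu : 0 ≤ u) (hud : u ≤ d) (hθ : θ ≤ 1) :
    d ^ θ * u ^ (1 - θ) ≤ d := by
  have hd := hu.trans hud
  calc d ^ θ * u ^ (1 - θ) ≤ d ^ θ * d ^ (1 - θ) := by
        have := sub_nonneg.2 hθ
        gcongr
    _ = d := by rw [← Real.rpow_add' hd (by simp)]; simp

lemma sum_mul_rpow_const_mul {ι : Type*} (s : Finset ι) {p c : ℝ} (hp : 0 < p) (hc : 0 ≤ c)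
    {a b : ι → ℝ} (ha : ∀ j, 0 ≤ a j) (hb : ∀ j, 0 ≤ b j) :
    (∑ j ∈ s, a j * (c * b j) ^ p) ^ (1 / p) = c * (∑ j ∈ s, a j * b j ^ p) ^ (1 / p) := by
  have h : ∑ j ∈ s, a j * (c * b j) ^ p = c ^ p * ∑ j ∈ s, a j * b j ^ p := by
    rw [Finset.mul_sum]
    refine Finset.sum_congr rfl fun j _ => ?_
    rw [Real.mul_rpow hc (hb j)]
    ring
  have h0 : 0 ≤ ∑ j ∈ s, a j * b j ^ p :=
    Finset.sum_nonneg fun j _ => mul_nonneg (ha j) (Real.rpow_nonneg (hb j) _)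
  rw [h, Real.mul_rpow (Real.rpow_nonneg hc _) h0, ← Real.rpow_mul hc, mul_one_div_cancel hp.ne',
    Real.rpow_one]

lemma sum_rpow_const_mul {ι : Type*} (s : Finset ι) {p c : ℝ} (hp : 0 < p) (hc : 0 ≤ c)
    {b : ι → ℝ} (hb : ∀ j, 0 ≤ b j) :
    (∑ j ∈ s, (c * b j) ^ p) ^ (1 / p) = c * (∑ j ∈ s, b j ^ p) ^ (1 / p) := by
  simpa using sum_mul_rpow_const_mul s hp hc (a := fun _ => 1) (by simp) hb

/-- A weighted three-factor Hölder inequality for series, with the constant function as one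
of the factors. -/
lemma tsum_mul_rpow_mul_rpow_le {ι : Type*} {p q α β : ℝ} (hp : 0 < p) (hq : 0 < q)
    (hα : 0 < α) (hβ : 0 < β) (hαβ : α / p + β / q ≤ 1) {w a c : ι → ℝ}
    (hw : ∀ i, 0 ≤ w i) (ha : ∀ i, 0 ≤ a i) (hc : ∀ i, 0 ≤ c i) (hw1 : HasSum w 1)
    (hsa : Summable fun i => w i * a i ^ p) (hsc : Summable fun i => w i * c i ^ q) :
    Summable (fun i => w i * (a i ^ α * c i ^ β)) ∧
      ∑' i, w i * (a i ^ α * c i ^ β) ≤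
        (∑' i, w i * a i ^ p) ^ (α / p) * (∑' i, w i * c i ^ q) ^ (β / q) := by
  have ha' : ∀ i, 0 ≤ w i * a i ^ p := fun i => mul_nonneg (hw i) (Real.rpow_nonneg (ha i) _)
  have hc' : ∀ i, 0 ≤ w i * c i ^ q := fun i => mul_nonneg (hw i) (Real.rpow_nonneg (hc i) _)
  set A := ∑' i, w i * a i ^ p with hA
  set B := ∑' i, w i * c i ^ q with hB
  have hA0 : 0 ≤ A := tsum_nonneg ha'
  have hB0 : 0 ≤ B := tsum_nonneg hc'
  -- If either total vanishes, so does every term of the product series, since `α` and `β` are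
  -- positive; the normalisation below needs both totals positive.
  rcases hA0.eq_or_lt with hA1 | hA1
  · have hz : ∀ i, w i * (a i ^ α * c i ^ β) = 0 := fun i => by
      have h := (hasSum_zero_iff_of_nonneg ha').1 (by rw [hA1]; exact hsa.hasSum)
      rcases mul_eq_zero.1 (congrFun h i) with h | h
      · simp [h]
      · simp [(Real.rpow_eq_zero (ha i) hp.ne').1 h, Real.zero_rpow hα.ne']
    simp only [hz, tsum_zero]
    exact ⟨summable_zero, mul_nonneg (Real.rpow_nonneg hA0 _) (Real.rpow_nonneg hB0 _)⟩
  rcases hB0.eq_or_lt with hB1 | hB1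
  · have hz : ∀ i, w i * (a i ^ α * c i ^ β) = 0 := fun i => by
      have h := (hasSum_zero_iff_of_nonneg hc').1 (by rw [hB1]; exact hsc.hasSum)
      rcases mul_eq_zero.1 (congrFun h i) with h | h
      · simp [h]
      · simp [(Real.rpow_eq_zero (hc i) hq.ne').1 h, Real.zero_rpow hβ.ne']
    simp only [hz, tsum_zero]
    exact ⟨summable_zero, mul_nonneg (Real.rpow_nonneg hA0 _) (Real.rpow_nonneg hB0 _)⟩
  set M := A ^ (α / p) * B ^ (β / q) with hM
  have hM0 : 0 < M := mul_pos (Real.rpow_pos_of_pos hA1 _) (Real.rpow_pos_of_pos hB1 _)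
  -- Weighted AM-GM for `a i ^ p / A`, `c i ^ q / B` and `1`. The third weight `1 - α / p - β / q`
  -- is the slack in the exponents, and the right-hand sides add up to exactly `M`.
  have key : ∀ i, w i * (a i ^ α * c i ^ β) ≤
      M * (α / p / A * (w i * a i ^ p) + β / q / B * (w i * c i ^ q)
        + (1 - α / p - β / q) * w i) := fun i => by
    have h := Real.geom_mean_le_arith_mean3_weighted (w₁ := α / p) (w₂ := β / q)
      (w₃ := 1 - α / p - β / q) (p₁ := a i ^ p / A) (p₂ := c i ^ q / B) (p₃ := 1)
      (by positivity) (by positivity) (by linarith)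
      (div_nonneg (Real.rpow_nonneg (ha i) _) hA0) (div_nonneg (Real.rpow_nonneg (hc i) _) hB0)
      zero_le_one (by ring)
    rw [Real.one_rpow, mul_one, mul_one, Real.div_rpow (Real.rpow_nonneg (ha i) _) hA0,
      Real.div_rpow (Real.rpow_nonneg (hc i) _) hB0, ← Real.rpow_mul (ha i),
      ← Real.rpow_mul (hc i), mul_div_cancel₀ _ hp.ne', mul_div_cancel₀ _ hq.ne',
      div_mul_div_comm, ← hM, div_le_iff₀ hM0] at h
    calc w i * (a i ^ α * c i ^ β) ≤ w i * _ := mul_le_mul_of_nonneg_left h (hw i)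
      _ = _ := by ring
  have hs : HasSum (fun i => M * (α / p / A * (w i * a i ^ p) + β / q / B * (w i * c i ^ q)
        + (1 - α / p - β / q) * w i)) M := by
    have h := ((((hsa.hasSum.mul_left (α / p / A)).add (hsc.hasSum.mul_left (β / q / B))).add
      (hw1.mul_left (1 - α / p - β / q)))).mul_left M
    rw [← hA, ← hB, div_mul_cancel₀ _ hA1.ne', div_mul_cancel₀ _ hB1.ne'] at h
    have e : M * (α / p + β / q + (1 - α / p - β / q) * 1) = M := by ring
    rwa [e] at h
  have h0 : ∀ i, 0 ≤ w i * (a i ^ α * c i ^ β) := fun i =>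
    mul_nonneg (hw i) (mul_nonneg (Real.rpow_nonneg (ha i) _) (Real.rpow_nonneg (hc i) _))
  have hsum := Summable.of_nonneg_of_le h0 key hs.summable
  exact ⟨hsum, hasSum_le key hsum.hasSum hs⟩

/-! ### Lipschitz maps and weak norms -/

section Lip

variable {X Y : Type*} [MetricSpace X] [MetricSpace Y]

lemma lipConst_nonneg (T : X → Y) : 0 ≤ lipConst T :=
  Real.sInf_nonneg fun _ h => h.1

lemma lipConst_le {T : X → Y} {K : ℝ} (hK : 0 ≤ K)
    (h : ∀ x y, dist (T x) (T y) ≤ K * dist x y) : lipConst T ≤ K :=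
  csInf_le ⟨0, fun _ h => h.1⟩ ⟨hK, h⟩

lemma IsLip.dist_le [Zero X] [Zero Y] {T : X → Y} (hT : IsLip T) (x y : X) :
    dist (T x) (T y) ≤ lipConst T * dist x y :=
  le_sInf_mul hT.2 dist_nonneg fun _ h => h.2 x y

variable {𝕜 : Type} [RCLike 𝕜] [Zero X]

lemma mem_lipDualBall_iff {f : X → 𝕜} :
    f ∈ lipDualBall 𝕜 X ↔ f 0 = 0 ∧ ∀ x y, ‖f x - f y‖ ≤ dist x y := by
  constructor
  · rintro ⟨h, h1⟩
    refine ⟨h.1, fun x y => ?_⟩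
    rw [← dist_eq_norm]
    exact (h.dist_le x y).trans (mul_le_of_le_one_left dist_nonneg h1)
  · rintro ⟨h, h1⟩
    have h2 : ∀ x y, dist (f x) (f y) ≤ 1 * dist x y := fun x y => by
      rw [dist_eq_norm, one_mul]
      exact h1 x y
    exact ⟨⟨h, 1, zero_le_one, h2⟩, lipConst_le zero_le_one h2⟩

instance : Nonempty (lipDualBall 𝕜 X) := ⟨⟨0, mem_lipDualBall_iff.2 (by simp)⟩⟩

lemma weakLipNorm_nonneg (p : ℝ) {m : ℕ} (σ : Fin m → ℝ) (x' x'' : Fin m → X) :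
    0 ≤ weakLipNorm 𝕜 p σ x' x'' :=
  Real.iSup_nonneg fun _ => by positivity

lemma le_weakLipNorm {p : ℝ} (hp : 0 ≤ p) {m : ℕ} (σ : Fin m → ℝ) (x' x'' : Fin m → X)
    {f : X → 𝕜} (hf : f ∈ lipDualBall 𝕜 X) :
    (∑ j, |σ j| ^ p * ‖f (x' j) - f (x'' j)‖ ^ p) ^ (1 / p) ≤ weakLipNorm 𝕜 p σ x' x'' := by
  refine le_ciSup (f := fun f : lipDualBall 𝕜 X =>
    (∑ j, |σ j| ^ p * ‖(f : X → 𝕜) (x' j) - (f : X → 𝕜) (x'' j)‖ ^ p) ^ (1 / p))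
    -- The strong norm bounds the family. Boundedness has to be supplied, since a real `⨆` over an
    -- unbounded family is `0`.
    ⟨(∑ j, |σ j| ^ p * dist (x' j) (x'' j) ^ p) ^ (1 / p), ?_⟩ ⟨f, hf⟩
  rintro _ ⟨g, rfl⟩
  have := (mem_lipDualBall_iff.1 g.2).2
  dsimp only
  gcongr
  exact this _ _

lemma weakLipNorm_le {p : ℝ} {m : ℕ} {σ : Fin m → ℝ} {x' x'' : Fin m → X} {M : ℝ}
    (h : ∀ f ∈ lipDualBall 𝕜 X,
      (∑ j, |σ j| ^ p * ‖f (x' j) - f (x'' j)‖ ^ p) ^ (1 / p) ≤ M) :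
    weakLipNorm 𝕜 p σ x' x'' ≤ M :=
  ciSup_le fun f => h f f.2

/-- If `f` is in the unit ball of the Lipschitz dual of `Y`, then `K⁻¹ • (f ∘ A)` is in that of `X`.
-/
lemma weakLipNorm_comp_le [Zero Y] {p : ℝ} (hp : 0 < p) {A : X → Y} {K : ℝ} (hK : 0 < K)
    (hA0 : A 0 = 0) (hA : ∀ x y, dist (A x) (A y) ≤ K * dist x y) {m : ℕ} (σ : Fin m → ℝ)
    (x' x'' : Fin m → X) :
    weakLipNorm 𝕜 p σ (fun j => A (x' j)) (fun j => A (x'' j)) ≤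
      K * weakLipNorm 𝕜 p σ x' x'' := by
  refine weakLipNorm_le fun f hf => ?_
  obtain ⟨hf0, hf1⟩ := mem_lipDualBall_iff.1 hf
  have hnorm : ∀ x y, ‖(K : 𝕜)⁻¹ * f (A x) - (K : 𝕜)⁻¹ * f (A y)‖ = K⁻¹ * ‖f (A x) - f (A y)‖ :=
    fun x y => by
      rw [← mul_sub, norm_mul, norm_inv, RCLike.norm_ofReal, abs_of_pos hK]
  have hg : (fun x => (K : 𝕜)⁻¹ * f (A x)) ∈ lipDualBall 𝕜 X := by
    refine mem_lipDualBall_iff.2 ⟨by simp [hA0, hf0], fun x y => ?_⟩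
    rw [hnorm, inv_mul_le_iff₀ hK]
    exact (hf1 _ _).trans (hA x y)
  have h := le_weakLipNorm hp.le σ x' x'' hg
  simp only [hnorm] at h
  rwa [sum_mul_rpow_const_mul _ hp (inv_nonneg.2 hK.le) (fun _ => by positivity)
    (fun _ => norm_nonneg _), inv_mul_le_iff₀ hK] at h

/-- Without the outer root the left side is additive in `p`-th powers of distances, so such bounds
can be averaged. -/
lemma lipSummingBound_iff {p C : ℝ} (hp : 0 < p) (hC : 0 ≤ C) {T : X → Y} :
    LipSummingBound 𝕜 p T C ↔
      ∀ (m : ℕ) (σ : Fin m → ℝ) (x' x'' : Fin m → X), (∀ j, 0 ≤ σ j) →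
        ∑ j, |σ j| ^ p * dist (T (x' j)) (T (x'' j)) ^ p ≤
          (C * weakLipNorm 𝕜 p σ x' x'') ^ p := by
  refine (and_iff_right hC).trans ?_
  refine forall_congr' fun m => forall_congr' fun σ => forall_congr' fun x' =>
    forall_congr' fun x'' => forall_congr' fun _ => ?_
  rw [strongLipNorm, one_div,
    Real.rpow_inv_le_iff_of_pos (Finset.sum_nonneg fun _ _ => by positivity)
      (mul_nonneg hC (weakLipNorm_nonneg _ _ _ _)) hp]

lemma lipSummingNorm_nonneg (p : ℝ) (T : X → Y) : 0 ≤ lipSummingNorm 𝕜 p T :=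
  Real.sInf_nonneg fun _ h => h.1

lemma LipSummingBound.norm_le {p C : ℝ} {T : X → Y} (h : LipSummingBound 𝕜 p T C) :
    lipSummingNorm 𝕜 p T ≤ C :=
  csInf_le ⟨0, fun _ h => h.1⟩ h

/-- Admissibility is a family of closed conditions on the constant, so the infimum is itself
admissible. -/
lemma IsLipSumming.bound [Zero Y] {p : ℝ} {T : X → Y} (h : IsLipSumming 𝕜 p T) :
    LipSummingBound 𝕜 p T (lipSummingNorm 𝕜 p T) :=
  ⟨lipSummingNorm_nonneg p T, fun m σ x' x'' hσ =>
    le_sInf_mul h.2 (weakLipNorm_nonneg _ _ _ _) fun _ hC => hC.2 m σ x' x'' hσ⟩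

/-- Test the summing inequality on a single pair of weight one, whose weak norm is at most the
distance. -/
lemma LipSummingBound.dist_le {p C : ℝ} (hp : 0 < p) {T : X → Y} (h : LipSummingBound 𝕜 p T C)
    (x y : X) : dist (T x) (T y) ≤ C * dist x y := by
  have h1 := h.2 1 (fun _ => 1) (fun _ => x) (fun _ => y) (fun _ => zero_le_one)
  have e : ∀ d : ℝ, 0 ≤ d → (d ^ p) ^ p⁻¹ = d := fun d hd => Real.rpow_rpow_inv hd hp.ne'
  have h2 : weakLipNorm 𝕜 p (fun _ : Fin 1 => 1) (fun _ => x) (fun _ => y) ≤ dist x y := by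
    refine weakLipNorm_le fun f hf => ?_
    simpa [e _ (norm_nonneg _)] using (mem_lipDualBall_iff.1 hf).2 x y
  refine le_trans ?_ (h1.trans (mul_le_mul_of_nonneg_left h2 h.1))
  simp [strongLipNorm, e _ dist_nonneg]

lemma LipSummingBound.comp {Z : Type*} [MetricSpace Z] [Zero Y] {p C K : ℝ} (hp : 0 < p)
    {S : Y → Z} (h : LipSummingBound 𝕜 p S C) {A : X → Y} (hK : 0 < K) (hA0 : A 0 = 0)
    (hA : ∀ x y, dist (A x) (A y) ≤ K * dist x y) :
    LipSummingBound 𝕜 p (fun x => S (A x)) (C * K) := by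
  refine ⟨mul_nonneg h.1 hK.le, fun m σ x' x'' hσ => ?_⟩
  refine (h.2 m σ (fun j => A (x' j)) (fun j => A (x'' j)) hσ).trans ?_
  rw [mul_assoc]
  exact mul_le_mul_of_nonneg_left (weakLipNorm_comp_le hp hK hA0 hA σ x' x'') h.1

lemma LipSummingBound.const_smul {G : Type*} [NormedAddCommGroup G] [NormedSpace 𝕜 G] {p C : ℝ}
    (hp : 0 < p) {S : X → G} (h : LipSummingBound 𝕜 p S C) (c : 𝕜) :
    LipSummingBound 𝕜 p (fun x => c • S x) (‖c‖ * C) := by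
  refine ⟨mul_nonneg (norm_nonneg _) h.1, fun m σ x' x'' hσ => ?_⟩
  have h1 := mul_le_mul_of_nonneg_left (h.2 m σ x' x'' hσ) (norm_nonneg c)
  rw [strongLipNorm] at h1 ⊢
  simp only [dist_smul₀]
  rwa [sum_mul_rpow_const_mul _ hp (norm_nonneg c) (fun _ => by positivity)
    (fun _ => dist_nonneg), mul_assoc]

lemma lipSummingBound_zero {G : Type*} [NormedAddCommGroup G] {p C : ℝ} (hp : 0 < p)
    (hC : 0 ≤ C) : LipSummingBound 𝕜 p (fun _ : X => (0 : G)) C := by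
  refine ⟨hC, fun m σ x' x'' _ => ?_⟩
  have : strongLipNorm p σ (fun _ => (0 : G)) (fun _ => (0 : G)) = 0 := by
    simp [strongLipNorm, hp.ne']
  exact this.trans_le (mul_nonneg hC (weakLipNorm_nonneg _ _ _ _))

end Lip

/-! ### Summing operators -/

section Summing

variable {𝕜 : Type} [RCLike 𝕜] {E H : Type*} [NormedAddCommGroup E] [NormedSpace 𝕜 E]
  [NormedAddCommGroup H] [NormedSpace 𝕜 H]

/-- The weak `ℓ_q` norm of a finite family of vectors. -/
noncomputable def weakNorm (𝕜 : Type) [RCLike 𝕜] {E : Type*} [NormedAddCommGroup E]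
    [NormedSpace 𝕜 E] (q : ℝ) {m : ℕ} (x : Fin m → E) : ℝ :=
  ⨆ a : Metric.closedBall (0 : StrongDual 𝕜 E) 1,
    (∑ j, ‖(a : StrongDual 𝕜 E) (x j)‖ ^ q) ^ (1 / q)

lemma weakNorm_nonneg (q : ℝ) {m : ℕ} (x : Fin m → E) : 0 ≤ weakNorm 𝕜 q x :=
  Real.iSup_nonneg fun _ => by positivity

lemma le_weakNorm {q : ℝ} (hq : 0 ≤ q) {m : ℕ} (x : Fin m → E) {a : StrongDual 𝕜 E}
    (ha : ‖a‖ ≤ 1) : (∑ j, ‖a (x j)‖ ^ q) ^ (1 / q) ≤ weakNorm 𝕜 q x := by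
  refine le_ciSup (f := fun a : Metric.closedBall (0 : StrongDual 𝕜 E) 1 =>
    (∑ j, ‖(a : StrongDual 𝕜 E) (x j)‖ ^ q) ^ (1 / q))
    ⟨(∑ j, ‖x j‖ ^ q) ^ (1 / q), ?_⟩ ⟨a, mem_closedBall_zero_iff.2 ha⟩
  rintro _ ⟨b, rfl⟩
  have := mem_closedBall_zero_iff.1 b.2
  dsimp only
  gcongr
  exact ContinuousLinearMap.le_of_opNorm_le_of_le _ this le_rfl |>.trans_eq (one_mul _)

lemma weakNorm_le {q : ℝ} {m : ℕ} {x : Fin m → E} {M : ℝ}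
    (h : ∀ a : StrongDual 𝕜 E, ‖a‖ ≤ 1 → (∑ j, ‖a (x j)‖ ^ q) ^ (1 / q) ≤ M) :
    weakNorm 𝕜 q x ≤ M := by
  have : Nonempty (Metric.closedBall (0 : StrongDual 𝕜 E) 1) := ⟨⟨0, by simp⟩⟩
  exact ciSup_le fun a => h a (mem_closedBall_zero_iff.1 a.2)

lemma weakNorm_comp_le {E₀ : Type*} [NormedAddCommGroup E₀] [NormedSpace 𝕜 E₀] {q : ℝ}
    (hq : 0 < q) {L : E₀ →L[𝕜] E} {K : ℝ} (hK : 0 < K) (hL : ‖L‖ ≤ K) {m : ℕ} (x : Fin m → E₀) :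
    weakNorm 𝕜 q (fun j => L (x j)) ≤ K * weakNorm 𝕜 q x := by
  refine weakNorm_le fun a ha => ?_
  have hK' : ‖(K : 𝕜)⁻¹‖ = K⁻¹ := by rw [norm_inv, RCLike.norm_ofReal, abs_of_pos hK]
  have hg : ‖(K : 𝕜)⁻¹ • a.comp L‖ ≤ 1 := by
    rw [norm_smul, hK', inv_mul_le_iff₀ hK]
    calc ‖a.comp L‖ ≤ ‖a‖ * ‖L‖ := a.opNorm_comp_le L
      _ ≤ 1 * K := by gcongr
      _ = K * 1 := mul_comm _ _
  have h := le_weakNorm hq.le x hg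
  simp only [smul_apply, ContinuousLinearMap.comp_apply, norm_smul, hK'] at h
  rwa [sum_rpow_const_mul _ hq (inv_nonneg.2 hK.le) (fun _ => norm_nonneg _),
    inv_mul_le_iff₀ hK] at h

lemma summingBound_iff {q C : ℝ} (hq : 0 < q) (hC : 0 ≤ C) {R : E →L[𝕜] H} :
    SummingBound q R C ↔
      ∀ (m : ℕ) (x : Fin m → E), ∑ j, ‖R (x j)‖ ^ q ≤ (C * weakNorm 𝕜 q x) ^ q := by
  refine (and_iff_right hC).trans ?_
  refine forall_congr' fun m => forall_congr' fun x => ?_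
  rw [← weakNorm, one_div, Real.rpow_inv_le_iff_of_pos (Finset.sum_nonneg fun _ _ => by positivity)
    (mul_nonneg hC (weakNorm_nonneg _ _)) hq]

lemma summingNorm_nonneg (q : ℝ) (R : E →L[𝕜] H) : 0 ≤ summingNorm q R :=
  Real.sInf_nonneg fun _ h => h.1

lemma SummingBound.norm_le {q C : ℝ} {R : E →L[𝕜] H} (h : SummingBound q R C) :
    summingNorm q R ≤ C :=
  csInf_le ⟨0, fun _ h => h.1⟩ h

lemma IsSumming.bound {q : ℝ} {R : E →L[𝕜] H} (h : IsSumming q R) :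
    SummingBound q R (summingNorm q R) :=
  ⟨summingNorm_nonneg q R, fun m x =>
    le_sInf_mul h (weakNorm_nonneg _ _) fun _ hC => hC.2 m x⟩

lemma SummingBound.norm_apply_le {q C : ℝ} (hq : 0 < q) {R : E →L[𝕜] H} (h : SummingBound q R C)
    (x : E) : ‖R x‖ ≤ C * ‖x‖ := by
  have h1 := h.2 1 (fun _ => x)
  have e : ∀ d : ℝ, 0 ≤ d → (d ^ q) ^ q⁻¹ = d := fun d hd => Real.rpow_rpow_inv hd hq.ne'
  have h2 : weakNorm 𝕜 q (fun _ : Fin 1 => x) ≤ ‖x‖ := by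
    refine weakNorm_le fun a ha => ?_
    simpa [e _ (norm_nonneg _)] using a.le_of_opNorm_le ha x
  refine le_trans ?_ (h1.trans (mul_le_mul_of_nonneg_left h2 h.1))
  simp [e _ (norm_nonneg _)]

lemma SummingBound.comp {E₀ : Type*} [NormedAddCommGroup E₀] [NormedSpace 𝕜 E₀] {q C K : ℝ}
    (hq : 0 < q) {R : E →L[𝕜] H} (h : SummingBound q R C) {L : E₀ →L[𝕜] E} (hK : 0 < K)
    (hL : ‖L‖ ≤ K) : SummingBound q (R.comp L) (C * K) := by
  refine ⟨mul_nonneg h.1 hK.le, fun m x => ?_⟩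
  refine (h.2 m (fun j => L (x j))).trans ?_
  rw [mul_assoc]
  exact mul_le_mul_of_nonneg_left (weakNorm_comp_le hq hK hL x) h.1

lemma SummingBound.const_smul {q C : ℝ} (hq : 0 < q) {R : E →L[𝕜] H} (h : SummingBound q R C)
    (c : 𝕜) : SummingBound q (c • R) (‖c‖ * C) := by
  refine ⟨mul_nonneg (norm_nonneg _) h.1, fun m x => ?_⟩
  have h1 := mul_le_mul_of_nonneg_left (h.2 m x) (norm_nonneg c)
  simp only [smul_apply, norm_smul]
  rwa [sum_rpow_const_mul _ hq (norm_nonneg c) (fun _ => norm_nonneg _), mul_assoc]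

lemma summingBound_zero {q C : ℝ} (hq : 0 < q) (hC : 0 ≤ C) :
    SummingBound q (0 : E →L[𝕜] H) C := by
  refine (summingBound_iff hq hC).2 fun m x => ?_
  simpa [Real.zero_rpow hq.ne'] using Real.rpow_nonneg (mul_nonneg hC (weakNorm_nonneg q x)) q

end Summing

/-! ### Weighted `ℓ_p` sums of summing maps -/

section LpSum

variable {𝕜 : Type} [RCLike 𝕜]

lemma norm_rpow_inv_smul_rpow {G : Type*} [NormedAddCommGroup G] [NormedSpace 𝕜 G] {p w : ℝ}
    (hp : 0 < p) (hw : 0 ≤ w) (v : G) :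
    ‖((w ^ p⁻¹ : ℝ) : 𝕜) • v‖ ^ p = w * ‖v‖ ^ p := by
  rw [norm_smul, RCLike.norm_ofReal, abs_of_nonneg (Real.rpow_nonneg hw _),
    Real.mul_rpow (Real.rpow_nonneg hw _) (norm_nonneg _), Real.rpow_inv_rpow hw hp.ne']

/-- A bound uniform in `i` survives averaging against the probability weights `w`. This is why `ℓ_p`
sums do not increase the summing constant. -/
lemma sum_tsum_mul_le {ι κ : Type*} (s : Finset κ) {w : ι → ℝ} (hw : ∀ i, 0 ≤ w i)
    (hw1 : HasSum w 1) {a : κ → ℝ} {f : ι → κ → ℝ} {n : κ → ℝ}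
    (hf : ∀ j, HasSum (fun i => w i * f i j) (n j)) {M : ℝ}
    (h : ∀ i, ∑ j ∈ s, a j * f i j ≤ M) : ∑ j ∈ s, a j * n j ≤ M := by
  have h1 : HasSum (fun i => ∑ j ∈ s, a j * (w i * f i j)) (∑ j ∈ s, a j * n j) :=
    hasSum_sum fun j _ => (hf j).mul_left (a j)
  have h2 : HasSum (fun i => w i * M) (1 * M) := hw1.mul_right M
  rw [one_mul] at h2
  refine hasSum_le (fun i => ?_) h1 h2
  calc ∑ j ∈ s, a j * (w i * f i j) = w i * ∑ j ∈ s, a j * f i j := by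
        rw [Finset.mul_sum]
        exact Finset.sum_congr rfl fun j _ => by ring
    _ ≤ w i * M := mul_le_mul_of_nonneg_left (h i) (hw i)

variable {ι : Type*} {G : ι → Type*} [∀ i, NormedAddCommGroup (G i)] [∀ i, NormedSpace 𝕜 (G i)]

lemma memℓp_rpow_inv_smul {p : ℝ} (hp : 1 ≤ p) {w : ι → ℝ}
    (hw : ∀ i, 0 ≤ w i) (hw1 : HasSum w 1) {v : ∀ i, G i} {M : ℝ} (hv : ∀ i, ‖v i‖ ≤ M) :
    Memℓp (fun i => (((w i) ^ p⁻¹ : ℝ) : 𝕜) • v i) (ENNReal.ofReal p) := by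
  have hp0 : 0 < p := zero_lt_one.trans_le hp
  refine memℓp_gen ?_
  simp only [ENNReal.toReal_ofReal hp0.le, norm_rpow_inv_smul_rpow hp0 (hw _)]
  refine Summable.of_nonneg_of_le (fun i => mul_nonneg (hw i) (by positivity)) (fun i => ?_)
    (hw1.summable.mul_right (M ^ p))
  have := hw i
  gcongr
  exact hv i

/-- Scaling the `i`-th coordinate by `w i ^ p⁻¹` turns the `p`-th power of the norm of a difference
into the `w`-average of the coordinate powers, and the summing inequality is stable under such
averages. -/
lemma exists_lp_lipSumming {X : Type*} [MetricSpace X] [Zero X] {p : ℝ} (hp : 1 ≤ p)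
    [Fact (1 ≤ ENNReal.ofReal p)] {S : ∀ i, X → G i}
    (hS0 : ∀ i, S i 0 = 0) (hS : ∀ i, LipSummingBound 𝕜 p (S i) 1) {w : ι → ℝ}
    (hw : ∀ i, 0 ≤ w i) (hw1 : HasSum w 1) :
    ∃ S' : X → lp G (ENNReal.ofReal p), S' 0 = 0 ∧ LipSummingBound 𝕜 p S' 1 ∧
      ∀ x y, HasSum (fun i => w i * ‖S i x - S i y‖ ^ p) (‖S' x - S' y‖ ^ p) := by
  have hp0 : 0 < p := zero_lt_one.trans_le hp
  have hmem : ∀ x, Memℓp (fun i => (((w i) ^ p⁻¹ : ℝ) : 𝕜) • S i x) (ENNReal.ofReal p) := fun x =>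
    memℓp_rpow_inv_smul hp hw hw1 (M := dist x 0) fun i => by
      simpa [hS0 i] using (hS i).dist_le hp0 x 0
  let S' : X → lp G (ENNReal.ofReal p) := fun x => ⟨_, hmem x⟩
  have hsum : ∀ x y, HasSum (fun i => w i * ‖S i x - S i y‖ ^ p) (‖S' x - S' y‖ ^ p) := by
    intro x y
    have h := lp.hasSum_norm (by rwa [ENNReal.toReal_ofReal hp0.le]) (S' x - S' y)
    rw [ENNReal.toReal_ofReal hp0.le] at h
    refine h.congr_fun fun i => ?_
    rw [← norm_rpow_inv_smul_rpow (𝕜 := 𝕜) hp0 (hw i), smul_sub]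
    rfl
  refine ⟨S', ?_, ?_, hsum⟩
  · ext i
    simp [S', hS0]
  · refine (lipSummingBound_iff hp0 zero_le_one).2 fun m σ x' x'' hσ => ?_
    refine sum_tsum_mul_le _ hw hw1 (fun j => by simpa only [dist_eq_norm] using hsum (x' j) (x'' j))
      fun i => ?_
    simpa only [dist_eq_norm] using (lipSummingBound_iff hp0 zero_le_one).1 (hS i) m σ x' x'' hσ

lemma exists_lp_summing {E : Type*} [NormedAddCommGroup E] [NormedSpace 𝕜 E] {q : ℝ} (hq : 1 ≤ q)
    [Fact (1 ≤ ENNReal.ofReal q)] {R : ∀ i, E →L[𝕜] G i}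
    (hR : ∀ i, SummingBound q (R i) 1) {w : ι → ℝ} (hw : ∀ i, 0 ≤ w i) (hw1 : HasSum w 1) :
    ∃ R' : E →L[𝕜] lp G (ENNReal.ofReal q), SummingBound q R' 1 ∧
      ∀ b, HasSum (fun i => w i * ‖R i b‖ ^ q) (‖R' b‖ ^ q) := by
  have hq0 : 0 < q := zero_lt_one.trans_le hq
  have hle : ∀ i b, ‖R i b‖ ≤ ‖b‖ := fun i b => by simpa using (hR i).norm_apply_le hq0 b
  let L : E →ₗ[𝕜] lp G (ENNReal.ofReal q) :=
    { toFun := fun b => ⟨fun i => (((w i) ^ q⁻¹ : ℝ) : 𝕜) • R i b,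
        memℓp_rpow_inv_smul hq hw hw1 fun i => hle i b⟩
      map_add' := fun b c => by
        ext i
        simp only [map_add, smul_add]
        rfl
      map_smul' := fun c b => by
        ext i
        simp [smul_comm c] }
  have hsum : ∀ b, HasSum (fun i => w i * ‖R i b‖ ^ q) (‖L b‖ ^ q) := by
    intro b
    have h := lp.hasSum_norm (by rwa [ENNReal.toReal_ofReal hq0.le]) (L b)
    rw [ENNReal.toReal_ofReal hq0.le] at h
    refine h.congr_fun fun i => ?_
    rw [← norm_rpow_inv_smul_rpow (𝕜 := 𝕜) hq0 (hw i)]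
    rfl
  have hbd : ∀ b, ‖L b‖ ≤ 1 * ‖b‖ := fun b => by
    rw [one_mul, ← Real.rpow_le_rpow_iff (norm_nonneg _) (norm_nonneg _) hq0]
    have h2 := hw1.mul_right (‖b‖ ^ q)
    rw [one_mul] at h2
    exact hasSum_le (fun i => mul_le_mul_of_nonneg_left
      (Real.rpow_le_rpow (norm_nonneg _) (hle i b) hq0.le) (hw i)) (hsum b) h2
  refine ⟨L.mkContinuous 1 hbd, ?_, hsum⟩
  refine (summingBound_iff hq0 zero_le_one).2 fun m x => ?_
  have h := sum_tsum_mul_le Finset.univ hw hw1 (a := fun _ => 1) (fun j => hsum (x j))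
    (M := (1 * weakNorm 𝕜 q x) ^ q) fun i => by
      simpa only [one_mul] using (summingBound_iff hq0 zero_le_one).1 (hR i) m x
  simp only [one_mul] at h ⊢
  exact h

end LpSum

/-! ### Normalised domination -/

section Bound

variable {𝕜 : Type} [RCLike 𝕜] {p θ q ν : ℝ} {X F : Type u} [MetricSpace X] [Zero X]
  [NormedAddCommGroup F] [NormedSpace 𝕜 F]

/-- `T` is dominated with constant `t` by a pair of summing maps whose summing norms are at
most one. -/
def DominatedBound (𝕜 : Type) [RCLike 𝕜] (p θ q ν : ℝ) {X F : Type u} [MetricSpace X] [Zero X]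
    [NormedAddCommGroup F] [NormedSpace 𝕜 F] (T : X → F) (t : ℝ) : Prop :=
  0 ≤ t ∧ T 0 = 0 ∧
    ∃ (G : Type u) (_ : NormedAddCommGroup G) (_ : NormedSpace 𝕜 G) (_ : CompleteSpace G)
      (H : Type u) (_ : NormedAddCommGroup H) (_ : NormedSpace 𝕜 H) (_ : CompleteSpace H)
      (S : X → G) (R : StrongDual 𝕜 F →L[𝕜] H),
      S 0 = 0 ∧ LipSummingBound 𝕜 p S 1 ∧ SummingBound q R 1 ∧
      ∀ (x' x'' : X) (b : StrongDual 𝕜 F),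
        ‖b (T x' - T x'')‖ ≤
          t * (dist x' x'' ^ θ * ‖S x' - S x''‖ ^ (1 - θ) * (‖b‖ ^ ν * ‖R b‖ ^ (1 - ν)))

lemma dominatedBound_zero (hp : 0 < p) (hq : 0 < q) {t : ℝ} (ht : 0 ≤ t) :
    DominatedBound 𝕜 p θ q ν (0 : X → F) t := by
  refine ⟨ht, rfl, PUnit, inferInstance, inferInstance, inferInstance,
    PUnit, inferInstance, inferInstance, inferInstance, fun _ => 0, 0, rfl,
    lipSummingBound_zero hp zero_le_one, summingBound_zero hq zero_le_one, fun x' x'' b => ?_⟩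
  simp only [Pi.zero_apply, sub_self, map_zero, norm_zero]
  positivity

/-- Normalised factors satisfy `‖S x - S y‖ ≤ dist x y` and `‖R b‖ ≤ ‖b‖`, so the interpolated bound
is at most `t * dist x y * ‖b‖`; testing against all functionals recovers the norm. -/
lemma DominatedBound.norm_sub_le (hp : 0 < p) (hq : 0 < q) (hθ : θ ≤ 1) (hν : ν ≤ 1)
    {T : X → F} {t : ℝ} (h : DominatedBound 𝕜 p θ q ν T t) (x y : X) :
    ‖T x - T y‖ ≤ t * dist x y := by
  obtain ⟨ht, -, G, _, _, _, H, _, _, _, S, R, -, hS, hR, h⟩ := h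
  refine NormedSpace.norm_le_dual_bound 𝕜 _ (mul_nonneg ht dist_nonneg) fun b => ?_
  refine (h x y b).trans ?_
  rw [mul_assoc t]
  refine mul_le_mul_of_nonneg_left ?_ ht
  have h1 : ‖S x - S y‖ ≤ dist x y := by
    simpa [dist_eq_norm] using hS.dist_le hp x y
  have h2 : ‖R b‖ ≤ ‖b‖ := by simpa using hR.norm_apply_le hq b
  exact mul_le_mul (rpow_mul_rpow_one_sub_le (norm_nonneg _) h1 hθ)
    (rpow_mul_rpow_one_sub_le (norm_nonneg _) h2 hν) (by positivity) dist_nonneg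

lemma DominatedBound.isLip (hp : 0 < p) (hq : 0 < q) (hθ : θ ≤ 1) (hν : ν ≤ 1)
    {T : X → F} {t : ℝ} (h : DominatedBound 𝕜 p θ q ν T t) : IsLip T :=
  ⟨h.2.1, t, h.1, fun x y => by
    simpa only [dist_eq_norm] using h.norm_sub_le hp hq hθ hν x y⟩

/-- Countable additivity of normalised domination. -/
lemma DominatedBound.hasSum (hp : 1 ≤ p) (hq : 1 ≤ q) (hθ : θ < 1) (hν : ν < 1)
    (hpq : (1 - θ) / p + (1 - ν) / q ≤ 1) {T : ℕ → X → F} {t : ℕ → ℝ} {T' : X → F} {t' : ℝ}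
    (h : ∀ i, DominatedBound 𝕜 p θ q ν (T i) (t i)) (ht : HasSum t t')
    (hT : ∀ x, HasSum (fun i => T i x) (T' x)) : DominatedBound 𝕜 p θ q ν T' t' := by
  have hp0 : 0 < p := zero_lt_one.trans_le hp
  have hq0 : 0 < q := zero_lt_one.trans_le hq
  have ht0 : ∀ i, 0 ≤ t i := fun i => (h i).1
  have ht' : 0 ≤ t' := ht.nonneg ht0
  -- The weights `t i / t'` require `t' ≠ 0`; when `t' = 0` all the summands vanish.
  rcases ht'.eq_or_lt with rfl | ht'
  · have htz := (hasSum_zero_iff_of_nonneg ht0).1 ht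
    have hz : T' = 0 := by
      funext x
      refine (hT x).unique ?_
      have hz : (fun i => T i x) = fun _ => 0 := by
        funext i
        have := (h i).norm_sub_le hp0 hq0 hθ.le hν.le x 0
        simpa [htz, (h i).2.1] using this
      rw [hz]
      exact hasSum_zero
    rw [hz]
    exact dominatedBound_zero hp0 hq0 le_rfl
  have hT0 : T' 0 = 0 := (hT 0).unique (by simp [(h _).2.1, hasSum_zero])
  choose _ _ G _ _ _ H _ _ _ S R hS0 hS hR hle using h
  have hw : ∀ i, 0 ≤ t i / t' := fun i => div_nonneg (ht0 i) ht'.le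
  have hw1 : HasSum (fun i => t i / t') 1 := by
    simpa [ht'.ne'] using ht.div_const t'
  have : Fact (1 ≤ ENNReal.ofReal p) := ⟨by simpa using ENNReal.ofReal_le_ofReal hp⟩
  have : Fact (1 ≤ ENNReal.ofReal q) := ⟨by simpa using ENNReal.ofReal_le_ofReal hq⟩
  obtain ⟨S', hS'0, hS', hSs⟩ := exists_lp_lipSumming hp hS0 hS hw hw1
  obtain ⟨R', hR', hRs⟩ := exists_lp_summing hq hR hw hw1
  refine ⟨ht'.le, hT0, lp G (ENNReal.ofReal p), inferInstance, inferInstance, inferInstance,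
    lp H (ENNReal.ofReal q), inferInstance, inferInstance, inferInstance, S', R', hS'0, hS', hR',
    fun x y b => ?_⟩
  -- Hölder at a fixed pair and functional. The factors `dist x y ^ θ` and `‖b‖ ^ ν` do not depend
  -- on `i`, so they stay outside the series.
  obtain ⟨hsum, hH⟩ := tsum_mul_rpow_mul_rpow_le hp0 hq0 (sub_pos.2 hθ) (sub_pos.2 hν) hpq hw
    (fun i => norm_nonneg (S i x - S i y)) (fun i => norm_nonneg (R i b)) hw1
    (hSs x y).summable (hRs b).summable
  rw [(hSs x y).tsum_eq, (hRs b).tsum_eq, ← Real.rpow_mul (norm_nonneg _),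
    ← Real.rpow_mul (norm_nonneg _), mul_div_cancel₀ _ hp0.ne', mul_div_cancel₀ _ hq0.ne'] at hH
  have hb : HasSum (fun i => b (T i x - T i y)) (b (T' x - T' y)) :=
    ((hT x).sub (hT y)).mapL b
  refine (hb.norm_le_of_bounded (hsum.hasSum.mul_left (t' * (dist x y ^ θ * ‖b‖ ^ ν)))
    fun i => ?_).trans ?_
  · refine (hle i x y b).trans_eq ?_
    field_simp
  · calc _ ≤ t' * (dist x y ^ θ * ‖b‖ ^ ν) * _ :=
          mul_le_mul_of_nonneg_left hH (by positivity)
      _ = _ := by ring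

lemma hasSum_ite_zero_one {M : Type*} [AddCommMonoid M] [TopologicalSpace M] (a b : M) :
    HasSum (fun i : ℕ => if i = 0 then a else if i = 1 then b else 0) (a + b) := by
  have := hasSum_sum_of_ne_finset_zero (s := Finset.range 2)
    (f := fun i : ℕ => if i = 0 then a else if i = 1 then b else 0) (L := .unconditional ℕ)
    fun i hi => by
      have : 1 < i := by simpa using hi
      rw [if_neg (by omega), if_neg (by omega)]
  simpa [Finset.sum_range_succ] using this

lemma DominatedBound.add (hp : 1 ≤ p) (hq : 1 ≤ q) (hθ : θ < 1) (hν : ν < 1)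
    (hpq : (1 - θ) / p + (1 - ν) / q ≤ 1) {T₁ T₂ : X → F} {t₁ t₂ : ℝ}
    (h₁ : DominatedBound 𝕜 p θ q ν T₁ t₁) (h₂ : DominatedBound 𝕜 p θ q ν T₂ t₂) :
    DominatedBound 𝕜 p θ q ν (T₁ + T₂) (t₁ + t₂) := by
  refine DominatedBound.hasSum hp hq hθ hν hpq
    (T := fun i => if i = 0 then T₁ else if i = 1 then T₂ else 0) (fun i => ?_)
    (hasSum_ite_zero_one t₁ t₂) fun x => ?_
  · split_ifs
    · exact h₁
    · exact h₂
    · exact dominatedBound_zero (zero_lt_one.trans_le hp) (zero_lt_one.trans_le hq) le_rfl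
  · refine (hasSum_ite_zero_one (T₁ x) (T₂ x)).congr_fun fun i => ?_
    split_ifs <;> rfl

/-- The new factors are `K⁻¹ • (S ∘ A)` and `‖B‖⁻¹ • (R ∘ B*)`, with `K` the Lipschitz constant of
`A`. Exponents `θ` and `1 - θ` add to one, so exactly one power of `K` comes out, and likewise one
of `‖B‖`. If either constant is zero the composite is zero. -/
lemma DominatedBound.comp (hp : 0 < p) (hq : 0 < q) (hθ₀ : 0 ≤ θ) (hν₀ : 0 ≤ ν)
    {X₀ F₀ : Type u} [MetricSpace X₀] [Zero X₀] [NormedAddCommGroup F₀] [NormedSpace 𝕜 F₀]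
    {T : X → F} {t : ℝ} (h : DominatedBound 𝕜 p θ q ν T t) (B : F →L[𝕜] F₀) {A : X₀ → X}
    (hA : IsLip A) :
    DominatedBound 𝕜 p θ q ν (fun x => B (T (A x))) (‖B‖ * t * lipConst A) := by
  have hA0 := lipConst_nonneg A
  obtain ⟨ht, hT0, G, _, _, _, H, _, _, _, S, R, hS0, hS, hR, h⟩ := h
  have hnn : 0 ≤ ‖B‖ * t * lipConst A := by positivity
  rcases hA0.eq_or_lt with hK | hK
  · have : (fun x => B (T (A x))) = 0 := by
      funext x
      have h1 : A x = A 0 := dist_le_zero.1 ((hA.dist_le x 0).trans_eq (by rw [← hK, zero_mul]))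
      simp [h1, hA.1, hT0]
    rw [this]
    exact dominatedBound_zero hp hq hnn
  rcases (norm_nonneg B).eq_or_lt with hB | hB
  · have : (fun x => B (T (A x))) = 0 := by
      funext x
      simp [norm_eq_zero.1 hB.symm]
    rw [this]
    exact dominatedBound_zero hp hq hnn
  set K := lipConst A with hKdef
  let L : StrongDual 𝕜 F₀ →L[𝕜] StrongDual 𝕜 F := ContinuousLinearMap.precomp 𝕜 B
  have hLb : ∀ b, ‖L b‖ ≤ ‖B‖ * ‖b‖ := fun b => (b.opNorm_comp_le B).trans_eq (mul_comm _ _)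
  have hL : ‖L‖ ≤ ‖B‖ := L.opNorm_le_bound (norm_nonneg _) hLb
  have hK' : ‖((K : ℝ) : 𝕜)⁻¹‖ = K⁻¹ := by rw [norm_inv, RCLike.norm_ofReal, abs_of_pos hK]
  have hB' : ‖((‖B‖ : ℝ) : 𝕜)⁻¹‖ = ‖B‖⁻¹ := by rw [norm_inv, RCLike.norm_ofReal, abs_of_pos hB]
  refine ⟨hnn, by simp [hA.1, hT0], G, inferInstance, inferInstance, inferInstance, H, inferInstance,
    inferInstance, inferInstance, fun x => (K : 𝕜)⁻¹ • S (A x), (‖B‖ : 𝕜)⁻¹ • R.comp L,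
    by simp [hA.1, hS0], ?_, ?_, fun x y b => ?_⟩
  · have := (hS.comp hp hK hA.1 hA.dist_le).const_smul hp (K : 𝕜)⁻¹
    rwa [hK', one_mul, inv_mul_cancel₀ hK.ne'] at this
  · have := (hR.comp hq hB hL).const_smul hq (‖B‖ : 𝕜)⁻¹
    rwa [hB', one_mul, inv_mul_cancel₀ hB.ne'] at this
  have e1 : ‖S (A x) - S (A y)‖ = K * ‖(K : 𝕜)⁻¹ • S (A x) - (K : 𝕜)⁻¹ • S (A y)‖ := by
    rw [← smul_sub, norm_smul, hK', mul_inv_cancel_left₀ hK.ne']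
  have e2 : ‖R (L b)‖ = ‖B‖ * ‖((‖B‖ : 𝕜)⁻¹ • R.comp L) b‖ := by
    rw [smul_apply, norm_smul, hB', mul_inv_cancel_left₀ hB.ne']
    rfl
  set s := ‖(K : 𝕜)⁻¹ • S (A x) - (K : 𝕜)⁻¹ • S (A y)‖
  set r := ‖((‖B‖ : 𝕜)⁻¹ • R.comp L) b‖
  have hs : 0 ≤ s := norm_nonneg _
  have hr : 0 ≤ r := norm_nonneg _
  have g1 : dist (A x) (A y) ^ θ * ‖S (A x) - S (A y)‖ ^ (1 - θ) ≤
      K * (dist x y ^ θ * s ^ (1 - θ)) := by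
    rw [e1]
    calc _ ≤ (K * dist x y) ^ θ * (K * s) ^ (1 - θ) := by
          gcongr
          exact hA.dist_le x y
      _ = K ^ θ * K ^ (1 - θ) * (dist x y ^ θ * s ^ (1 - θ)) := by
          rw [Real.mul_rpow hK.le dist_nonneg, Real.mul_rpow hK.le hs]
          ring
      _ = _ := by rw [← Real.rpow_add hK]; simp
  have g2 : ‖L b‖ ^ ν * ‖R (L b)‖ ^ (1 - ν) ≤ ‖B‖ * (‖b‖ ^ ν * r ^ (1 - ν)) := by
    rw [e2]
    calc _ ≤ (‖B‖ * ‖b‖) ^ ν * (‖B‖ * r) ^ (1 - ν) := by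
          gcongr
          exact hLb b
      _ = ‖B‖ ^ ν * ‖B‖ ^ (1 - ν) * (‖b‖ ^ ν * r ^ (1 - ν)) := by
          rw [Real.mul_rpow hB.le (norm_nonneg _), Real.mul_rpow hB.le hr]
          ring
      _ = _ := by rw [← Real.rpow_add hB]; simp
  calc ‖b (B (T (A x)) - B (T (A y)))‖ = ‖L b (T (A x) - T (A y))‖ := by
        rw [← map_sub]
        rfl
    _ ≤ _ := h (A x) (A y) (L b)
    _ ≤ t * (K * (dist x y ^ θ * s ^ (1 - θ)) * (‖B‖ * (‖b‖ ^ ν * r ^ (1 - ν)))) :=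
        mul_le_mul_of_nonneg_left (mul_le_mul g1 g2 (by positivity) (by positivity)) ht
    _ = _ := by ring

/-- Both factors are scalar valued: `g` divided by its Lipschitz constant, and evaluation at `e /
‖e‖` on the dual. Each lies in the relevant unit ball, so it is one of the competitors in the
supremum defining the weak norm. -/
lemma dominatedBound_tensor (hp : 0 < p) (hq : 0 < q) (hθ₀ : 0 ≤ θ) (hν₀ : 0 ≤ ν) {g : X → 𝕜}
    (hg : IsLip g) (e : F) :
    DominatedBound 𝕜 p θ q ν (fun x => g x • e) (lipConst g * ‖e‖) := by
  have hK0 := lipConst_nonneg g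
  have hnn : 0 ≤ lipConst g * ‖e‖ := by positivity
  rcases hK0.eq_or_lt with hK | hK
  · have : (fun x => g x • e) = 0 := by
      funext x
      have h1 : g x = g 0 := dist_le_zero.1 ((hg.dist_le x 0).trans_eq (by rw [← hK, zero_mul]))
      simp [h1, hg.1]
    rw [this]
    exact dominatedBound_zero hp hq hnn
  rcases (norm_nonneg e).eq_or_lt with he | he
  · have : (fun x => g x • e) = 0 := by
      funext x
      simp [norm_eq_zero.1 he.symm]
    rw [this]
    exact dominatedBound_zero hp hq hnn
  set K := lipConst g with hKdef
  have hK' : ‖((K : ℝ) : 𝕜)⁻¹‖ = K⁻¹ := by rw [norm_inv, RCLike.norm_ofReal, abs_of_pos hK]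
  have he' : ‖((‖e‖ : ℝ) : 𝕜)⁻¹‖ = ‖e‖⁻¹ := by rw [norm_inv, RCLike.norm_ofReal, abs_of_pos he]
  let f : X → 𝕜 := fun x => (K : 𝕜)⁻¹ * g x
  have hfn : ∀ x y, ‖f x - f y‖ = K⁻¹ * ‖g x - g y‖ := fun x y => by
    simp only [f]
    rw [← mul_sub, norm_mul, hK']
  have hf : f ∈ lipDualBall 𝕜 X := mem_lipDualBall_iff.2 ⟨by simp [f, hg.1], fun x y => by
    rw [hfn, inv_mul_le_iff₀ hK, ← dist_eq_norm]
    exact hg.dist_le x y⟩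
  let φ : StrongDual 𝕜 (StrongDual 𝕜 F) := (‖e‖ : 𝕜)⁻¹ • NormedSpace.inclusionInDoubleDual 𝕜 F e
  have hφn : ∀ b, ‖φ b‖ = ‖e‖⁻¹ * ‖b e‖ := fun b => by
    simp only [φ, smul_apply, norm_smul, he', NormedSpace.dual_def]
  have hφb : ∀ b, ‖φ b‖ ≤ ‖b‖ := fun b => by
    rw [hφn, inv_mul_le_iff₀ he, mul_comm]
    exact b.le_opNorm e
  have hφ : ‖φ‖ ≤ 1 := φ.opNorm_le_bound zero_le_one fun b => by simpa using hφb b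
  -- The scalars live in `Type`, while the factor spaces must live in `Type u`.
  let U : 𝕜 →L[𝕜] ULift.{u} 𝕜 := (ContinuousLinearEquiv.ulift (R₁ := 𝕜) (M₁ := 𝕜)).symm
  have hU : ∀ z, ‖U z‖ = ‖z‖ := fun _ => rfl
  refine ⟨hnn, by simp [hg.1], ULift.{u} 𝕜, inferInstance, inferInstance, inferInstance,
    ULift.{u} 𝕜, inferInstance, inferInstance, inferInstance, fun x => U (f x), U.comp φ,
    by simp [f, hg.1], ⟨zero_le_one, fun m σ x' x'' _ => ?_⟩, ⟨zero_le_one, fun m x => ?_⟩,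
    fun x y b => ?_⟩
  · rw [one_mul, strongLipNorm]
    simp only [dist_eq_norm, ← map_sub, hU]
    exact le_weakLipNorm hp.le σ x' x'' hf
  · rw [one_mul]
    exact le_weakNorm hq.le x hφ
  · rw [← map_sub, hU, ContinuousLinearMap.comp_apply, hU, ← sub_smul, map_smul, smul_eq_mul,
      norm_mul]
    calc ‖g x - g y‖ * ‖b e‖ = K * ‖e‖ * (‖f x - f y‖ * ‖φ b‖) := by
          rw [hfn, hφn]
          field_simp
      _ ≤ _ := by
          refine mul_le_mul_of_nonneg_left ?_ hnn
          have := le_rpow_mul_rpow_one_sub (norm_nonneg _) ((mem_lipDualBall_iff.1 hf).2 x y) hθ₀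
          have := le_rpow_mul_rpow_one_sub (norm_nonneg _) (hφb b) hν₀
          gcongr

end Bound

/-! ### The dominated norm -/

section Norm

variable {𝕜 : Type} [RCLike 𝕜] {p θ q ν : ℝ} {X F : Type u} [MetricSpace X] [Zero X]
  [NormedAddCommGroup F] [NormedSpace 𝕜 F]

lemma Dominates.value_nonneg {G H : Type*} [NormedAddCommGroup G] [NormedSpace 𝕜 G]
    [NormedAddCommGroup H] [NormedSpace 𝕜 H] {T : X → F} {S : X → G}
    {R : StrongDual 𝕜 F →L[𝕜] H} {C : ℝ} (h : Dominates p θ q ν T S R C) :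
    0 ≤ C * lipSummingNorm 𝕜 p S ^ (1 - θ) * summingNorm q R ^ (1 - ν) :=
  mul_nonneg (mul_nonneg h.2.2.1.le (Real.rpow_nonneg (lipSummingNorm_nonneg p S) _))
    (Real.rpow_nonneg (summingNorm_nonneg q R) _)

lemma dominates_of_bounds {G H : Type*} [NormedAddCommGroup G] [NormedSpace 𝕜 G]
    [NormedAddCommGroup H] [NormedSpace 𝕜 H] (hp : 0 < p) {T : X → F} {t C : ℝ} (htC : t ≤ C)
    (hC : 0 < C) {S : X → G} {R : StrongDual 𝕜 F →L[𝕜] H} (hS0 : S 0 = 0)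
    (hS : LipSummingBound 𝕜 p S 1) (hR : SummingBound q R 1)
    (h : ∀ (x' x'' : X) (b : StrongDual 𝕜 F), ‖b (T x' - T x'')‖ ≤
      t * (dist x' x'' ^ θ * ‖S x' - S x''‖ ^ (1 - θ) * (‖b‖ ^ ν * ‖R b‖ ^ (1 - ν)))) :
    Dominates p θ q ν T S R C := by
  refine ⟨⟨⟨hS0, 1, zero_le_one, hS.dist_le hp⟩, 1, hS⟩, ⟨1, hR⟩, hC, fun x y b => ?_⟩
  calc _ ≤ _ := h x y b
    _ ≤ C * (dist x y ^ θ * ‖S x - S y‖ ^ (1 - θ) * (‖b‖ ^ ν * ‖R b‖ ^ (1 - ν))) := by gcongr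
    _ = _ := by ring

variable [CompleteSpace F]

lemma dominatedNorm_nonneg (T : X → F) : 0 ≤ dominatedNorm 𝕜 p θ q ν X F T := by
  refine Real.sInf_nonneg ?_
  rintro c ⟨G, _, _, _, H, _, _, _, S, R, C, h, rfl⟩
  exact h.value_nonneg

lemma DominatedBound.mem_dominated (hp : 0 < p) (hq : 0 < q) (hθ : θ ≤ 1) (hν : ν ≤ 1)
    {T : X → F} {t : ℝ} (h : DominatedBound 𝕜 p θ q ν T t) : T ∈ dominated 𝕜 p θ q ν X F := by
  refine ⟨h.isLip hp hq hθ hν, ?_⟩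
  obtain ⟨ht, -, G, _, _, _, H, _, _, _, S, R, hS0, hS, hR, h⟩ := h
  exact ⟨G, inferInstance, inferInstance, inferInstance, H, inferInstance, inferInstance,
    inferInstance, S, R, t + 1,
    dominates_of_bounds hp (by linarith) (by linarith) hS0 hS hR h⟩

/-- Here `t` may be zero while `Dominates` asks for a positive constant, so `t + ε` is used and `ε`
is arbitrary. -/
lemma DominatedBound.dominatedNorm_le (hp : 0 < p) (hθ : θ ≤ 1) (hν : ν ≤ 1) {T : X → F} {t : ℝ}
    (h : DominatedBound 𝕜 p θ q ν T t) : dominatedNorm 𝕜 p θ q ν X F T ≤ t := by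
  refine le_of_forall_pos_le_add fun ε hε => ?_
  obtain ⟨ht, -, G, _, _, _, H, _, _, _, S, R, hS0, hS, hR, h⟩ := h
  have hC : 0 < t + ε := by linarith
  have hd := dominates_of_bounds hp (by linarith) hC hS0 hS hR h
  refine le_trans (csInf_le ⟨0, ?_⟩ (by exact ⟨G, inferInstance, inferInstance, inferInstance,
    H, inferInstance, inferInstance, inferInstance, S, R, t + ε, hd, rfl⟩)) ?_
  · rintro c ⟨G, _, _, _, H, _, _, _, S, R, C, h, rfl⟩
    exact h.value_nonneg
  · have h1 : lipSummingNorm 𝕜 p S ^ (1 - θ) ≤ 1 :=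
      Real.rpow_le_one (lipSummingNorm_nonneg p S) hS.norm_le (sub_nonneg.2 hθ)
    have h2 : summingNorm q R ^ (1 - ν) ≤ 1 :=
      Real.rpow_le_one (summingNorm_nonneg q R) hR.norm_le (sub_nonneg.2 hν)
    calc (t + ε) * lipSummingNorm 𝕜 p S ^ (1 - θ) * summingNorm q R ^ (1 - ν)
        ≤ (t + ε) * 1 * 1 := by
          gcongr
          exact Real.rpow_nonneg (summingNorm_nonneg q R) _
      _ = t + ε := by ring

lemma dominatedBound_of_dominatedNorm_lt (hp : 0 < p) (hq : 0 < q) (hθ : θ < 1) (hν : ν < 1)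
    {T : X → F} (hT : T ∈ dominated 𝕜 p θ q ν X F) {t : ℝ}
    (ht : dominatedNorm 𝕜 p θ q ν X F T < t) : DominatedBound 𝕜 p θ q ν T t := by
  obtain ⟨⟨hT0, -⟩, G, i₁, i₂, i₃, H, i₄, i₅, i₆, S, R, C, h⟩ := hT
  have ht0 : 0 ≤ t := (dominatedNorm_nonneg T).trans ht.le
  obtain ⟨_, ⟨G, _, _, _, H, _, _, _, S, R, C, ⟨hS, hR, hC, h⟩, rfl⟩, hlt⟩ :=
    exists_lt_of_csInf_lt (by exact ⟨_, G, i₁, i₂, i₃, H, i₄, i₅, i₆, S, R, C, h, rfl⟩) ht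
  have hSb := hS.bound
  have hRb := hR.bound
  have eq_zero (hz : ∀ (x : X) (b : StrongDual 𝕜 F), b (T x - T 0) = 0) : T = 0 := by
    funext x
    have := SeparatingDual.eq_zero_of_forall_dual_eq_zero (hz x)
    rwa [hT0, sub_zero] at this
  -- A factor of summing norm zero cannot be normalised, but it is constant (or zero, for `R`), and
  -- the positive exponent `1 - θ` (or `1 - ν`) then forces `T = 0`.
  rcases (lipSummingNorm_nonneg (𝕜 := 𝕜) p S).eq_or_lt with hs | hs
  · rw [eq_zero fun x b => ?_]
    · exact dominatedBound_zero hp hq ht0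
    · have h1 : ‖S x - S 0‖ = 0 := by
        have := hSb.dist_le hp x 0
        rw [← hs, zero_mul, dist_eq_norm] at this
        exact le_antisymm this (norm_nonneg _)
      have h2 := h x 0 b
      rw [h1, Real.zero_rpow (sub_pos.2 hθ).ne'] at h2
      simpa using h2
  rcases (summingNorm_nonneg q R).eq_or_lt with hr | hr
  · rw [eq_zero fun x b => ?_]
    · exact dominatedBound_zero hp hq ht0
    · have h1 : ‖R b‖ = 0 := by
        have := hRb.norm_apply_le hq b
        rw [← hr, zero_mul] at this
        exact le_antisymm this (norm_nonneg _)
      have h2 := h x 0 b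
      rw [h1, Real.zero_rpow (sub_pos.2 hν).ne'] at h2
      simpa using h2
  set s := lipSummingNorm 𝕜 p S
  set r := summingNorm q R
  have hs' : ‖(s : 𝕜)⁻¹‖ = s⁻¹ := by rw [norm_inv, RCLike.norm_ofReal, abs_of_pos hs]
  have hr' : ‖(r : 𝕜)⁻¹‖ = r⁻¹ := by rw [norm_inv, RCLike.norm_ofReal, abs_of_pos hr]
  refine ⟨ht0, hT0, G, inferInstance, inferInstance, inferInstance, H, inferInstance,
    inferInstance, inferInstance, fun x => (s : 𝕜)⁻¹ • S x, (r : 𝕜)⁻¹ • R, by simp [hS.1.1],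
    ?_, ?_, fun x y b => ?_⟩
  · simpa [hs', hs.ne'] using hSb.const_smul hp (s : 𝕜)⁻¹
  · simpa [hr', hr.ne'] using hRb.const_smul hq (r : 𝕜)⁻¹
  · have e1 : ‖S x - S y‖ = s * ‖(s : 𝕜)⁻¹ • S x - (s : 𝕜)⁻¹ • S y‖ := by
      rw [← smul_sub, norm_smul, hs', mul_inv_cancel_left₀ hs.ne']
    have e2 : ‖R b‖ = r * ‖((r : 𝕜)⁻¹ • R) b‖ := by
      rw [smul_apply, norm_smul, hr', mul_inv_cancel_left₀ hr.ne']
    refine (h x y b).trans ?_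
    rw [e1, e2, Real.mul_rpow hs.le (norm_nonneg _), Real.mul_rpow hr.le (norm_nonneg _)]
    calc _ = C * s ^ (1 - θ) * r ^ (1 - ν) *
          (dist x y ^ θ * ‖(s : 𝕜)⁻¹ • S x - (s : 𝕜)⁻¹ • S y‖ ^ (1 - θ) *
            (‖b‖ ^ ν * ‖((r : 𝕜)⁻¹ • R) b‖ ^ (1 - ν))) := by ring
      _ ≤ _ := by gcongr

lemma norm_sub_le_dominatedNorm (hp : 0 < p) (hq : 0 < q) (hθ : θ < 1) (hν : ν < 1)
    {T : X → F} (hT : T ∈ dominated 𝕜 p θ q ν X F) (x y : X) :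
    ‖T x - T y‖ ≤ dominatedNorm 𝕜 p θ q ν X F T * dist x y := by
  refine ge_of_tendsto (x := 𝓝[>] (dominatedNorm 𝕜 p θ q ν X F T)) (f := fun t => t * dist x y)
    ((Continuous.tendsto (by fun_prop) _).mono_left nhdsWithin_le_nhds) ?_
  filter_upwards [self_mem_nhdsWithin] with t ht
  exact (dominatedBound_of_dominatedNorm_lt hp hq hθ hν hT ht).norm_sub_le hp hq hθ.le hν.le x y

lemma dominated_comp (hp : 0 < p) (hq : 0 < q) (hθ₀ : 0 ≤ θ) (hθ : θ < 1) (hν₀ : 0 ≤ ν)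
    (hν : ν < 1) {X₀ F₀ : Type u} [MetricSpace X₀] [Zero X₀] [NormedAddCommGroup F₀]
    [NormedSpace 𝕜 F₀] [CompleteSpace F₀] {T : X → F} (hT : T ∈ dominated 𝕜 p θ q ν X F)
    (B : F →L[𝕜] F₀) {A : X₀ → X} (hA : IsLip A) :
    (fun x => B (T (A x))) ∈ dominated 𝕜 p θ q ν X₀ F₀ ∧
      dominatedNorm 𝕜 p θ q ν X₀ F₀ (fun x => B (T (A x))) ≤
        ‖B‖ * dominatedNorm 𝕜 p θ q ν X F T * lipConst A := by
  have h : ∀ t, dominatedNorm 𝕜 p θ q ν X F T < t →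
      DominatedBound 𝕜 p θ q ν (fun x => B (T (A x))) (‖B‖ * t * lipConst A) := fun t ht =>
    (dominatedBound_of_dominatedNorm_lt hp hq hθ hν hT ht).comp hp hq hθ₀ hν₀ B hA
  refine ⟨(h _ (lt_add_one _)).mem_dominated hp hq hθ.le hν.le, ?_⟩
  refine ge_of_tendsto (x := 𝓝[>] (dominatedNorm 𝕜 p θ q ν X F T))
    (f := fun t => ‖B‖ * t * lipConst A)
    ((Continuous.tendsto (by fun_prop) _).mono_left nhdsWithin_le_nhds) ?_
  filter_upwards [self_mem_nhdsWithin] with t ht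
  exact (h t ht).dominatedNorm_le hp hθ.le hν.le

lemma dominated_add (hp : 1 ≤ p) (hq : 1 ≤ q) (hθ : θ < 1) (hν : ν < 1)
    (hpq : (1 - θ) / p + (1 - ν) / q ≤ 1) {S T : X → F} (hS : S ∈ dominated 𝕜 p θ q ν X F)
    (hT : T ∈ dominated 𝕜 p θ q ν X F) :
    S + T ∈ dominated 𝕜 p θ q ν X F ∧
      dominatedNorm 𝕜 p θ q ν X F (S + T) ≤
        dominatedNorm 𝕜 p θ q ν X F S + dominatedNorm 𝕜 p θ q ν X F T := by
  have hp0 : 0 < p := zero_lt_one.trans_le hp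
  have hq0 : 0 < q := zero_lt_one.trans_le hq
  have h : ∀ s t, dominatedNorm 𝕜 p θ q ν X F S < s → dominatedNorm 𝕜 p θ q ν X F T < t →
      DominatedBound 𝕜 p θ q ν (S + T) (s + t) := fun s t hs ht =>
    (dominatedBound_of_dominatedNorm_lt hp0 hq0 hθ hν hS hs).add hp hq hθ hν hpq
      (dominatedBound_of_dominatedNorm_lt hp0 hq0 hθ hν hT ht)
  refine ⟨(h _ _ (lt_add_one _) (lt_add_one _)).mem_dominated hp0 hq0 hθ.le hν.le, ?_⟩
  refine le_of_forall_pos_le_add fun ε hε => ?_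
  refine ((h _ _ (lt_add_of_pos_right _ (half_pos hε))
    (lt_add_of_pos_right _ (half_pos hε))).dominatedNorm_le hp0 hθ.le hν.le).trans_eq ?_
  ring

lemma dominated_zero (hp : 0 < p) (hq : 0 < q) (hθ : θ ≤ 1) (hν : ν ≤ 1) :
    (0 : X → F) ∈ dominated 𝕜 p θ q ν X F ∧ dominatedNorm 𝕜 p θ q ν X F (0 : X → F) = 0 := by
  have h := dominatedBound_zero (𝕜 := 𝕜) (X := X) (F := F) (θ := θ) (ν := ν) hp hq le_rfl
  exact ⟨h.mem_dominated hp hq hθ hν,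
    le_antisymm (h.dominatedNorm_le hp hθ hν) (dominatedNorm_nonneg _)⟩

/-- Scalar multiplication is composition with `c • id` on `F` and `id` on `X`, so the ideal property
applies. Only upper bounds on `‖id‖` and the Lipschitz constant of `id` are used, as either may be
zero on a trivial space. -/
lemma dominated_smul (hp : 0 < p) (hq : 0 < q) (hθ₀ : 0 ≤ θ) (hθ : θ < 1) (hν₀ : 0 ≤ ν)
    (hν : ν < 1) (c : 𝕜) {T : X → F} (hT : T ∈ dominated 𝕜 p θ q ν X F) :
    c • T ∈ dominated 𝕜 p θ q ν X F ∧
      dominatedNorm 𝕜 p θ q ν X F (c • T) ≤ ‖c‖ * dominatedNorm 𝕜 p θ q ν X F T := by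
  have h1 : ∀ x y : X, dist (id x) (id y) ≤ 1 * dist x y := by simp
  have hid : IsLip (id : X → X) := ⟨rfl, 1, zero_le_one, h1⟩
  obtain ⟨hm, hn⟩ := dominated_comp hp hq hθ₀ hθ hν₀ hν hT (c • ContinuousLinearMap.id 𝕜 F) hid
  have e : (fun x => (c • ContinuousLinearMap.id 𝕜 F) (T (id x))) = c • T := rfl
  rw [e] at hm hn
  refine ⟨hm, hn.trans ?_⟩
  have hc : ‖c • ContinuousLinearMap.id 𝕜 F‖ ≤ ‖c‖ := by
    rw [norm_smul]
    exact mul_le_of_le_one_right (norm_nonneg _) ContinuousLinearMap.norm_id_le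
  have := dominatedNorm_nonneg (𝕜 := 𝕜) (p := p) (θ := θ) (q := q) (ν := ν) T
  calc _ ≤ ‖c‖ * dominatedNorm 𝕜 p θ q ν X F T * 1 := by
        gcongr
        · exact lipConst_nonneg _
        · exact lipConst_le zero_le_one h1
    _ = _ := mul_one _

lemma dominatedNorm_smul (hp : 0 < p) (hq : 0 < q) (hθ₀ : 0 ≤ θ) (hθ : θ < 1) (hν₀ : 0 ≤ ν)
    (hν : ν < 1) (c : 𝕜) {T : X → F} (hT : T ∈ dominated 𝕜 p θ q ν X F) :
    dominatedNorm 𝕜 p θ q ν X F (c • T) = ‖c‖ * dominatedNorm 𝕜 p θ q ν X F T := by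
  obtain ⟨hm, hn⟩ := dominated_smul hp hq hθ₀ hθ hν₀ hν c hT
  refine le_antisymm hn ?_
  rcases eq_or_ne c 0 with rfl | hc
  · simpa using dominatedNorm_nonneg _
  · have h := (dominated_smul hp hq hθ₀ hθ hν₀ hν c⁻¹ hm).2
    rw [inv_smul_smul₀ hc, norm_inv, ← div_eq_inv_mul, le_div_iff₀ (norm_pos_iff.2 hc)] at h
    rwa [mul_comm]

lemma dominated_sub (hp : 1 ≤ p) (hq : 1 ≤ q) (hθ₀ : 0 ≤ θ) (hθ : θ < 1) (hν₀ : 0 ≤ ν)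
    (hν : ν < 1) (hpq : (1 - θ) / p + (1 - ν) / q ≤ 1) {S T : X → F}
    (hS : S ∈ dominated 𝕜 p θ q ν X F) (hT : T ∈ dominated 𝕜 p θ q ν X F) :
    S - T ∈ dominated 𝕜 p θ q ν X F := by
  have hp0 : 0 < p := zero_lt_one.trans_le hp
  have hq0 : 0 < q := zero_lt_one.trans_le hq
  have h := (dominated_add hp hq hθ hν hpq hS
    (dominated_smul hp0 hq0 hθ₀ hθ hν₀ hν (-1 : 𝕜) hT).1).1
  rwa [neg_one_smul, ← sub_eq_add_neg] at h

lemma dominatedNorm_tensor (hp : 0 < p) (hq : 0 < q) (hθ₀ : 0 ≤ θ) (hθ : θ < 1) (hν₀ : 0 ≤ ν)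
    (hν : ν < 1) {g : X → 𝕜} (hg : IsLip g) (e : F) :
    dominatedNorm 𝕜 p θ q ν X F (fun x => g x • e) = lipConst g * ‖e‖ := by
  have hb := dominatedBound_tensor hp hq hθ₀ hν₀ hg e
  refine le_antisymm (hb.dominatedNorm_le hp hθ.le hν.le) ?_
  rcases (norm_nonneg e).eq_or_lt with he | he
  · rw [← he, mul_zero]
    exact dominatedNorm_nonneg _
  rw [← le_div_iff₀ he]
  -- The dominated norm is a Lipschitz constant for `g ⊡ e`, whose increments have norm `‖g x - g y‖
  -- * ‖e‖`.
  refine lipConst_le (div_nonneg (dominatedNorm_nonneg _) he.le) fun x y => ?_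
  have h := norm_sub_le_dominatedNorm hp hq hθ hν (hb.mem_dominated hp hq hθ.le hν.le) x y
  rw [← sub_smul, norm_smul, ← dist_eq_norm] at h
  rw [div_mul_eq_mul_div, le_div_iff₀ he]
  exact h

lemma dominated_complete (hp : 1 ≤ p) (hq : 1 ≤ q) (hθ₀ : 0 ≤ θ) (hθ : θ < 1) (hν₀ : 0 ≤ ν)
    (hν : ν < 1) (hpq : (1 - θ) / p + (1 - ν) / q ≤ 1) {T : ℕ → X → F}
    (hT : ∀ n, T n ∈ dominated 𝕜 p θ q ν X F)
    (hc : ∀ ε : ℝ, 0 < ε → ∃ n₀, ∀ m ≥ n₀, ∀ n ≥ n₀,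
      dominatedNorm 𝕜 p θ q ν X F (T m - T n) < ε) :
    ∃ T' ∈ dominated 𝕜 p θ q ν X F,
      Tendsto (fun n => dominatedNorm 𝕜 p θ q ν X F (T n - T')) atTop (𝓝 0) := by
  have hp0 : 0 < p := zero_lt_one.trans_le hp
  have hq0 : 0 < q := zero_lt_one.trans_le hq
  have hsub : ∀ m n, T m - T n ∈ dominated 𝕜 p θ q ν X F := fun m n =>
    dominated_sub hp hq hθ₀ hθ hν₀ hν hpq (hT m) (hT n)
  have hcau : ∀ x, CauchySeq fun n => T n x := fun x => by
    refine Metric.cauchySeq_iff.2 fun ε hε => ?_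
    obtain ⟨n₀, hn₀⟩ := hc (ε / (dist x 0 + 1)) (by positivity)
    refine ⟨n₀, fun m hm n hn => ?_⟩
    have h := norm_sub_le_dominatedNorm hp0 hq0 hθ hν (hsub m n) x 0
    simp only [Pi.sub_apply, (hT _).1.1, sub_zero] at h
    rw [dist_eq_norm]
    calc _ ≤ _ := h
      _ ≤ dominatedNorm 𝕜 p θ q ν X F (T m - T n) * (dist x 0 + 1) :=
          mul_le_mul_of_nonneg_left (by linarith) (dominatedNorm_nonneg _)
      _ < ε := (lt_div_iff₀ (by positivity)).1 (hn₀ m hm n hn)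
  choose T' hT' using fun x => cauchySeq_tendsto_of_complete (hcau x)
  -- Sum the differences along a fast subsequence that starts at a given late term.
  have hclose : ∀ ε : ℝ, 0 < ε → ∃ n₀, ∀ n ≥ n₀, DominatedBound 𝕜 p θ q ν (T' - T n) ε := by
    intro ε hε
    have hpow : ∀ k : ℕ, 0 < ε / 2 / 2 ^ k := fun k => by positivity
    choose N hN using fun k => hc _ (hpow k)
    refine ⟨N 0, fun n hn => ?_⟩
    -- Starting at `M 0 = n` makes the increments telescope to `T' - T n`. The maximum keeps `M`
    -- strictly increasing and beyond the Cauchy thresholds, and the bounds `ε / 2 / 2 ^ k` sum to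
    -- `ε`.
    let M : ℕ → ℕ := fun k => k.rec n fun j m => max (m + 1) (N (j + 1))
    have hMs : ∀ k, M (k + 1) = max (M k + 1) (N (k + 1)) := fun _ => rfl
    have hMN : ∀ k, N k ≤ M k := fun k => by
      cases k with
      | zero => exact hn
      | succ k => rw [hMs]; exact le_max_right _ _
    have hmono : StrictMono M := strictMono_nat_of_lt_succ fun k => by
      rw [hMs]; exact (Nat.lt_succ_self _).trans_le (le_max_left _ _)
    have hb : ∀ k, DominatedBound 𝕜 p θ q ν (T (M (k + 1)) - T (M k)) (ε / 2 / 2 ^ k) := fun k =>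
      dominatedBound_of_dominatedNorm_lt hp0 hq0 hθ hν (hsub _ _)
        (hN k _ ((hMN k).trans (hmono.monotone k.le_succ)) _ (hMN k))
    refine DominatedBound.hasSum hp hq hθ hν hpq hb (hasSum_geometric_two' ε) fun x => ?_
    have hsm : Summable fun k => (T (M (k + 1)) - T (M k)) x := by
      refine Summable.of_norm_bounded ((summable_geometric_two' ε).mul_right (dist x 0))
        fun k => ?_
      have := (hb k).norm_sub_le hp0 hq0 hθ.le hν.le x 0
      rwa [(hb k).2.1, sub_zero] at this
    refine (hsm.hasSum_iff_tendsto_nat).2 ?_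
    have hs : ∀ j, ∑ k ∈ Finset.range j, (T (M (k + 1)) - T (M k)) x = T (M j) x - T n x :=
      fun j => Finset.sum_range_sub (fun k => T (M k) x) j
    simp only [hs]
    exact ((hT' x).comp hmono.tendsto_atTop).sub_const _
  refine ⟨T', ?_, ?_⟩
  · obtain ⟨n₀, hn₀⟩ := hclose 1 one_pos
    have := (dominated_add hp hq hθ hν hpq
      ((hn₀ n₀ le_rfl).mem_dominated hp0 hq0 hθ.le hν.le) (hT n₀)).1
    rwa [sub_add_cancel] at this
  · refine Metric.tendsto_atTop.2 fun ε hε => ?_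
    obtain ⟨n₀, hn₀⟩ := hclose (ε / 2) (half_pos hε)
    refine ⟨n₀, fun n hn => ?_⟩
    have h := hn₀ n hn
    -- Homogeneity with scalar `-1` exchanges `T' - T n` for `T n - T'`.
    have h1 := dominatedNorm_smul hp0 hq0 hθ₀ hθ hν₀ hν (-1 : 𝕜)
      (h.mem_dominated hp0 hq0 hθ.le hν.le)
    rw [neg_one_smul, neg_sub, norm_neg, norm_one, one_mul] at h1
    rw [Real.dist_0_eq_abs, h1, abs_of_nonneg (dominatedNorm_nonneg _)]
    linarith [h.dominatedNorm_le hp0 hθ.le hν.le]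

end Norm

end NonlinearIdeal

open NonlinearIdeal in
theorem mainTheorem3 (𝕜 : Type) [RCLike 𝕜] (p q r θ ν : ℝ) (hp : 1 ≤ p) (hq : 1 ≤ q) (hr : 1 ≤ r)
    (hθ₀ : 0 ≤ θ) (hθ₁ : θ < 1) (hν₀ : 0 ≤ ν) (hν₁ : ν < 1)
    (hpqr : 1 / r + (1 - θ) / p + (1 - ν) / q = 1) :
    NonlinearIdeal.IsBanachNonlinearIdeal.{u} 𝕜
      (NonlinearIdeal.dominated.{u} 𝕜 p θ q ν) (NonlinearIdeal.dominatedNorm.{u} 𝕜 p θ q ν) := by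
  have hp0 : 0 < p := zero_lt_one.trans_le hp
  have hq0 : 0 < q := zero_lt_one.trans_le hq
  -- The exponent `r` enters only through `1 / r ≥ 0`, the share of the constant factor in Hölder's
  -- inequality.
  have hpq : (1 - θ) / p + (1 - ν) / q ≤ 1 := by
    have : 0 ≤ 1 / r := by positivity
    linarith
  constructor
  case exponent_pos => exact one_pos
  case exponent_le_one => exact le_rfl
  case isLip => exact fun X F _ _ _ _ _ T hT => hT.1
  case tensor_mem =>
    exact fun X F _ _ _ _ _ g e hg =>
      (dominatedBound_tensor hp0 hq0 hθ₀ hν₀ hg e).mem_dominated hp0 hq0 hθ₁.le hν₁.le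
  case tensor_norm =>
    exact fun X F _ _ _ _ _ g e hg => dominatedNorm_tensor hp0 hq0 hθ₀ hθ₁ hν₀ hν₁ hg e
  case add_mem =>
    exact fun X F _ _ _ _ _ S T hS hT => (dominated_add hp hq hθ₁ hν₁ hpq hS hT).1
  case add_norm =>
    intro X F _ _ _ _ _ S T hS hT
    simpa only [Real.rpow_one] using (dominated_add hp hq hθ₁ hν₁ hpq hS hT).2
  case comp_mem =>
    exact fun X₀ X F F₀ _ _ _ _ _ _ _ _ _ _ B T A hA hT =>
      (dominated_comp hp0 hq0 hθ₀ hθ₁ hν₀ hν₁ hT B hA).1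
  case comp_norm =>
    exact fun X₀ X F F₀ _ _ _ _ _ _ _ _ _ _ B T A hA hT =>
      (dominated_comp hp0 hq0 hθ₀ hθ₁ hν₀ hν₁ hT B hA).2
  case smul_mem =>
    exact fun X F _ _ _ _ _ c T hT => (dominated_smul hp0 hq0 hθ₀ hθ₁ hν₀ hν₁ c hT).1
  case norm_nonneg => exact fun X F _ _ _ _ _ T _ => dominatedNorm_nonneg T
  case norm_eq_zero =>
    intro X F _ _ _ _ _ T hT
    refine ⟨fun h => ?_, ?_⟩
    · funext x
      have h1 := norm_sub_le_dominatedNorm hp0 hq0 hθ₁ hν₁ hT x 0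
      rw [h, zero_mul, hT.1.1, sub_zero] at h1
      exact norm_le_zero_iff.1 h1
    · rintro rfl
      exact (dominated_zero hp0 hq0 hθ₁.le hν₁.le).2
  case norm_smul =>
    exact fun X F _ _ _ _ _ c T hT => dominatedNorm_smul hp0 hq0 hθ₀ hθ₁ hν₀ hν₁ c hT
  case complete =>
    exact fun X F _ _ _ _ _ T hT hc => dominated_complete hp hq hθ₀ hθ₁ hν₀ hν₁ hpq hT hc
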